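/- **Theorem 1.2.** Let $\Xi=\{(x,n)\in\mathbb Z\times\mathbb Z_{\ge 0}: |x|+n \text{ even}\}$, and let $E$ be the set of directed edges from $(x,n)\in\Xi$ to $(x\pm1,n+1)$. Let $\{X_e: e\in E\}$ be independent $\mathcal N(0,1)$ random variables on a probability space $(\Omega,\mathcal F,P)$, and let $$Z_n=\sup_{\gamma}\sum_{e\in\gamma}X_e ,$$ where $\gamma$ ranges over the directed paths in $(\Xi,E)$ with $n$ edges that start at $(0,0)$. Then there is a (nonrandom) real constant $\mu$ such that $\lim_{n\to\infty} Z_n/n=\mu$ almost surely, and for every sufficiently small $\varepsilon>0$, $$-\infty<\liminf_{n\to\infty}\frac{\log n}{n^2}\log P\bigl(Z_n\le(\mu-\varepsilon)n\bigr)\le\limsup_{n\to\infty}\frac{\log n}{n^2}\log P\bigl(Z_n\le(\mu-\varepsilon)n\bigr)<0 .$$ Here $\log$ is the natural logarithm; any other fixed base greater than $1$ gives an equivalent statement. -/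

import Mathlib

open MeasureTheory ProbabilityTheory Filter Topology

namespace DirectedPercolation

/-- The vertex set `Ξ`: points `(x, n) ∈ ℤ × ℤ₊` with `|x| + n` even. -/
def Site : Type := {p : ℤ × ℕ // Even (|p.1| + (p.2 : ℤ))}

/-- The spatial coordinate `x` of `(x, n)`. -/
def Site.pos (u : Site) : ℤ := u.1.1

/-- The time coordinate `n` of `(x, n)`. -/
def Site.time (u : Site) : ℕ := u.1.2

/-- The vertex `(0, 0)`. -/
def origin : Site := ⟨(0, 0), by simp⟩

/-- There is a directed edge from `(x, n)` to `(x + 1, n + 1)` and to `(x - 1, n + 1)`. -/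
def IsEdge (u v : Site) : Prop :=
  (v.pos = u.pos + 1 ∨ v.pos = u.pos - 1) ∧ v.time = u.time + 1

/-- The set `E` of directed edges. -/
def Edge : Type := {e : Site × Site // IsEdge e.1 e.2}

/-- Directed nearest-neighbour paths with `n` steps that start at the origin; they end at
time `n`, at an arbitrary position. -/
structure Path (n : ℕ) where
  /-- The vertices visited. -/
  site : Fin (n + 1) → Site
  start : site 0 = origin
  step : ∀ i : Fin n, IsEdge (site i.castSucc) (site i.succ)

/-- The `i`-th edge of a path. -/
def Path.edge {n : ℕ} (γ : Path n) (i : Fin n) : Edge :=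
  ⟨(γ.site i.castSucc, γ.site i.succ), γ.step i⟩

/-- The value of a path in the edge weights `w`: the sum of the weights of its edges. -/
def Path.value {n : ℕ} (w : Edge → ℝ) (γ : Path n) : ℝ := ∑ i, w (γ.edge i)

/-- The last passage time `Z_n`: the supremum of the values of the `n`-step paths from the
origin. It is over a non-empty finite set, by the two instances below. -/
noncomputable def lastPassage (w : Edge → ℝ) (n : ℕ) : ℝ := ⨆ γ : Path n, γ.value w

instance (n : ℕ) : Nonempty (Path n) :=
  ⟨{ site := fun i => ⟨((i : ℕ), (i : ℕ)), by simp⟩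
     start := rfl
     step := fun i => by simp [IsEdge, Site.pos, Site.time] }⟩

theorem Path.site_bound {n : ℕ} (γ : Path n) (i : Fin (n + 1)) :
    (γ.site i).time = (i : ℕ) ∧ |(γ.site i).pos| ≤ ((i : ℕ) : ℤ) := by
  induction i using Fin.induction with
  | zero => simp [γ.start, origin, Site.time, Site.pos]
  | succ i ih =>
    obtain ⟨h1, h2⟩ := γ.step i
    simp only [Fin.val_castSucc, abs_le] at ih
    simp only [Fin.val_succ, abs_le]
    push_cast
    omega

instance (n : ℕ) : Finite (Path n) := by
  have hS : (Set.Icc (-(n : ℤ)) n ×ˢ Set.Iic n).Finite :=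
    (Set.finite_Icc _ _).prod (Set.finite_Iic n)
  have := hS.to_subtype
  refine Finite.of_injective (β := Fin (n + 1) → (Set.Icc (-(n : ℤ)) n ×ˢ Set.Iic n))
    (fun γ i => ⟨(γ.site i).1, ?_⟩) ?_
  · have h := γ.site_bound i
    have hi := i.is_le
    simp only [Site.time, Site.pos, abs_le] at h
    simp only [Set.mem_prod, Set.mem_Icc, Set.mem_Iic]
    omega
  · rintro ⟨f, _, _⟩ ⟨g, _, _⟩ h
    have : f = g := by
      funext i
      have := congrFun h i
      exact Subtype.ext (by simpa using this)
    subst this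
    rfl

end DirectedPercolation

/-!
Put `t` for the time and `i` for the number of up-steps. In these coordinates (`Bond`) the weights
form a field of independent standard Gaussian variables, and the last passage time is the maximum
`maxVal (words n)` over lists of `n` steps (`lastPassage_eq_maxVal`, `hasLaw_gaussianField`).

*Concentration.* A path crosses exactly one edge at each time, so resampling all the weights at one
time changes a maximum over paths by at most the largest of `O(n)` differences of Gaussian
variables. Exposing the weights one time after the other shows that such maxima are sub-Gaussian
with parameter `fluct n`, of order `n ^ (3 / 2)` (`hasSubgaussianMGF_maxVal`); anything negligible
against `n ^ 2 / log n` would do.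

*Law of large numbers.* The expected last passage time straight ahead is superadditive, which
defines the time constant `timeConst` by Fekete's lemma. Concentration makes the choice of the
endpoint cheap, and a path to any endpoint followed by the reflected path leads straight ahead, so
the expected point-to-line time has the same constant (`tendsto_mean_words_div`). Borel–Cantelli
concludes (`ae_tendsto_maxVal_words_div`).

*Upper bound on the lower tail.* Let a random walk spread out like a Pólya urn for a small fraction
of the time, so that it is uniform on the `t + 1` sites at each time `t`, and then continue straight
ahead along a tube made of blocks of a large fixed length. The maximum is at least the average of
the values over this walk. The average weight collected by the walk is Gaussian with variance of
order `∑ 1 / t ∼ log n`, since each edge at time `t` is used with probability of order `1 / t`. The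
tubes contribute an average, over about `n` tubes, of sums of about `n` block times, independent up
to local overlaps and each with an expectation close to the time constant times its length; the
fluctuations of this average are of order one. The whole is sub-Gaussian with parameter of
order `log n`, and a deviation of order `n` costs `n ^ 2 / log n` (`exists_measureReal_le_exp`).

*Lower bound on the lower tail.* Let `G` be the sum of the weights of the edges that paths can use,
each multiplied by `tilt e = 1 / (t + 1)`. The projection of the field on the direction `tilt` adds
the same amount `G / 2` to the value of every path, because `tilt` depends on the time only. So the
maximum is `G / 2` plus a variable independent of `G` (`indepFun_maxVal_sub_tilt`). The latter is at
most `(timeConst + ε) * n` with probability at least `1 / 2`, and `G`, of variance of order `log n`,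
is below `-4 * ε * n` with probability at least `exp (-C * n ^ 2 / log n)`
(`exists_exp_le_measureReal`).
-/

namespace DirectedPercolation

/-! ### Concentration for functions of independent variables -/

section Concentration

variable {E : Type*} [MeasurableSpace E]

theorem integrable_of_abs_le {Ω : Type*} [MeasurableSpace Ω] {P : Measure Ω} [IsFiniteMeasure P]
    {f : Ω → ℝ} (hf : Measurable f) {M : ℝ} (hM : ∀ x, |f x| ≤ M) : Integrable f P :=
  Integrable.of_bound hf.aestronglyMeasurable M (ae_of_all _ hM)

theorem integrable_exp_of_abs_le {Ω : Type*} [MeasurableSpace Ω] {P : Measure Ω}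
    [IsFiniteMeasure P] {f : Ω → ℝ} (hf : Measurable f) {M : ℝ} (hM : ∀ x, |f x| ≤ M) :
    Integrable (fun x => Real.exp (f x)) P :=
  integrable_of_abs_le hf.exp (M := Real.exp M) fun x => by
    rw [abs_of_pos (Real.exp_pos _)]
    exact Real.exp_le_exp.2 ((le_abs_self _).trans (hM x))

/-- Symmetrization: the centered exponential moment of `g` is at most that of `g x - g y` for an
independent copy `y`, and the latter is an integral of `cosh`. -/
theorem integral_exp_sub_integral_le {ν : Measure E} [IsProbabilityMeasure ν] {g : E → ℝ}
    (hg : Measurable g) {M : ℝ} (hM : ∀ x, |g x| ≤ M) {d : E → E → ℝ}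
    (hlip : ∀ x y, |g x - g y| ≤ d x y) (s : ℝ)
    (hint : Integrable (fun p : E × E => Real.cosh (s * d p.1 p.2)) (ν.prod ν)) :
    ∫ x, Real.exp (s * (g x - ∫ y, g y ∂ν)) ∂ν
      ≤ ∫ p, Real.cosh (s * d p.1 p.2) ∂(ν.prod ν) := by
  have hgi : Integrable g ν := integrable_of_abs_le hg hM
  have hdiff : ∀ x y, |s * (g x - g y)| ≤ |s| * (M + M) := fun x y => by
    rw [abs_mul]
    gcongr
    exact (abs_sub _ _).trans (add_le_add (hM x) (hM y))
  have hm2 : Measurable fun p : E × E => s * (g p.1 - g p.2) := by fun_prop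
  have hE2 : Integrable (fun p : E × E => Real.exp (s * (g p.1 - g p.2))) (ν.prod ν) :=
    integrable_exp_of_abs_le hm2 fun p => hdiff p.1 p.2
  have hE2' : Integrable (fun p : E × E => Real.exp (s * (g p.2 - g p.1))) (ν.prod ν) :=
    hE2.swap
  have hmean : ∀ x, |g x - ∫ y, g y ∂ν| ≤ M + M := fun x => by
    refine (abs_sub _ _).trans (add_le_add (hM x) ?_)
    have := norm_integral_le_of_norm_le_const (μ := ν) (f := g) (C := M) (ae_of_all _ hM)
    simpa using this
  have hE1 : Integrable (fun x => Real.exp (s * (g x - ∫ y, g y ∂ν))) ν :=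
    integrable_exp_of_abs_le (M := |s| * (M + M)) (by fun_prop) fun x => by
      rw [abs_mul]; gcongr; exact hmean x
  have h1 : ∫ x, Real.exp (s * (g x - ∫ y, g y ∂ν)) ∂ν
      ≤ ∫ x, ∫ y, Real.exp (s * (g x - g y)) ∂ν ∂ν := by
    refine integral_mono hE1 hE2.integral_prod_left fun x => ?_
    have hx : Integrable (fun y => s * (g x - g y)) ν := ((integrable_const _).sub hgi).const_mul s
    have hJ := convexOn_exp.map_integral_le (μ := ν) (f := fun y => s * (g x - g y))
      Real.continuous_exp.continuousOn isClosed_univ (by simp) hx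
      (integrable_exp_of_abs_le (by fun_prop) (hdiff x))
    have heq : ∫ y, s * (g x - g y) ∂ν = s * (g x - ∫ y, g y ∂ν) := by
      rw [integral_const_mul, integral_sub (integrable_const _) hgi]
      simp
    simpa [heq] using hJ
  have hswap : ∫ p, Real.exp (s * (g p.2 - g p.1)) ∂(ν.prod ν)
      = ∫ p, Real.exp (s * (g p.1 - g p.2)) ∂(ν.prod ν) :=
    integral_prod_swap (μ := ν) (ν := ν) (fun p : E × E => Real.exp (s * (g p.1 - g p.2)))
  have h2 : ∫ x, ∫ y, Real.exp (s * (g x - g y)) ∂ν ∂ν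
      = ∫ p, Real.cosh (s * (g p.1 - g p.2)) ∂(ν.prod ν) := by
    rw [← integral_prod _ hE2]
    have : ∀ p : E × E, Real.cosh (s * (g p.1 - g p.2))
        = (Real.exp (s * (g p.1 - g p.2)) + Real.exp (s * (g p.2 - g p.1))) / 2 := fun p => by
      rw [Real.cosh_eq]; ring_nf
    simp_rw [this]
    rw [integral_div, integral_add hE2 hE2', hswap]
    ring
  have hC : ∀ p : E × E, Real.cosh (s * (g p.1 - g p.2)) ≤ Real.cosh (s * d p.1 p.2) := fun p => by
    rw [Real.cosh_le_cosh, abs_mul, abs_mul]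
    exact mul_le_mul_of_nonneg_left ((hlip p.1 p.2).trans (le_abs_self _)) (abs_nonneg _)
  refine h1.trans (h2.le.trans (integral_mono_of_nonneg (ae_of_all _ fun p => ?_) hint
    (ae_of_all _ hC)))
  exact (Real.cosh_pos _).le

/-- Exponential concentration of a bounded function of `n` independent `E`-valued variables with law
`ν` whose oscillation in each of them is at most `d`: integrating out the variables one at a time,
each contributes the factor of `integral_exp_sub_integral_le`. -/
theorem integral_exp_pi_le_of_bounded {ν : Measure E} [IsProbabilityMeasure ν] {d : E → E → ℝ}
    (s : ℝ) (hint : Integrable (fun p : E × E => Real.cosh (s * d p.1 p.2)) (ν.prod ν)) (n : ℕ) :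
    ∀ {F : (Fin n → E) → ℝ}, Measurable F → ∀ {M : ℝ}, (∀ w, |F w| ≤ M) →
    (∀ w i y, |F (Function.update w i y) - F w| ≤ d y (w i)) →
    ∫ w, Real.exp (s * (F w - ∫ w', F w' ∂(Measure.pi fun _ => ν))) ∂(Measure.pi fun _ => ν)
      ≤ (∫ p, Real.cosh (s * d p.1 p.2) ∂(ν.prod ν)) ^ n := by
  induction n with
  | zero =>
    intro F hF M hM hlip
    have : ∀ w : Fin 0 → E, F w = F default := fun w => congrArg F (Subsingleton.elim _ _)
    simp [this]
  | succ n ih =>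
    intro F hF M hM hlip
    have hmp := measurePreserving_piFinSuccAbove (fun _ : Fin (n + 1) => ν) 0
    set π := Measure.pi (fun _ : Fin n => ν) with hπ
    let e := MeasurableEquiv.piFinSuccAbove (fun _ : Fin (n + 1) => E) 0
    let f : E × (Fin n → E) → ℝ := fun p => F (Fin.cons p.1 p.2)
    have hfe : ∀ w, F w = f (e w) := fun w => by
      simp only [f]
      congr 1
      funext i
      refine Fin.cases ?_ (fun i => ?_) i <;> simp [e, MeasurableEquiv.piFinSuccAbove, Fin.tail]
    have hf : Measurable f := by
      have : f = F ∘ e.symm := by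
        funext p
        simp [hfe]
      rw [this]
      exact hF.comp e.symm.measurable
    have htr : ∀ h : E × (Fin n → E) → ℝ,
        ∫ w, h (e w) ∂(Measure.pi fun _ : Fin (n + 1) => ν) = ∫ p, h p ∂(ν.prod π) := fun h =>
      hmp.integral_comp e.measurableEmbedding h
    have hfM : ∀ p, |f p| ≤ M := fun p => hM _
    simp_rw [hfe]
    rw [htr f, htr fun p => Real.exp (s * (f p - ∫ p', f p' ∂(ν.prod π)))]
    have hfi : Integrable f (ν.prod π) := integrable_of_abs_le hf hfM
    let g : E → ℝ := fun x => ∫ w, f (x, w) ∂π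
    have hg : Measurable g := (hf.stronglyMeasurable.integral_prod_right').measurable
    have hgM : ∀ x, |g x| ≤ M := fun x => by
      have := norm_integral_le_of_norm_le_const (μ := π) (f := fun w => f (x, w)) (C := M)
        (ae_of_all _ fun w => hfM _)
      simpa using this
    have hsec : ∀ x, Integrable (fun w => f (x, w)) π := fun x =>
      integrable_of_abs_le (by fun_prop) fun w => hfM _
    have hfI : ∫ p, f p ∂(ν.prod π) = ∫ x, g x ∂ν := integral_prod _ hfi
    have hglip : ∀ x y, |g x - g y| ≤ d x y := fun x y => by
      have h1 : g x - g y = ∫ w, (f (x, w) - f (y, w)) ∂π := (integral_sub (hsec x) (hsec y)).symm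
      rw [h1]
      have := norm_integral_le_of_norm_le_const (μ := π) (f := fun w => f (x, w) - f (y, w))
        (C := d x y) (ae_of_all _ fun w => by
          have := hlip (Fin.cons y w) 0 x
          simpa [f, Fin.update_cons_zero] using this)
      simpa using this
    have hgI : |∫ x, g x ∂ν| ≤ M := by
      have := norm_integral_le_of_norm_le_const (μ := ν) (f := g) (C := M) (ae_of_all _ hgM)
      simpa using this
    have hbd : ∀ p, |s * (f p - ∫ x, g x ∂ν)| ≤ |s| * (M + M) := fun p => by
      rw [abs_mul]; gcongr
      exact (abs_sub _ _).trans (add_le_add (hfM p) hgI)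
    rw [hfI, integral_prod _ (integrable_exp_of_abs_le (by fun_prop) hbd)]
    set C := ∫ p, Real.cosh (s * d p.1 p.2) ∂(ν.prod ν) with hC
    have hC0 : 0 ≤ C := integral_nonneg fun p => (Real.cosh_pos _).le
    have hstep : ∀ x, ∫ w, Real.exp (s * (f (x, w) - ∫ x, g x ∂ν)) ∂π
        ≤ Real.exp (s * (g x - ∫ x, g x ∂ν)) * C ^ n := fun x => by
      have h1 : ∀ w, Real.exp (s * (f (x, w) - ∫ x, g x ∂ν))
          = Real.exp (s * (g x - ∫ x, g x ∂ν)) * Real.exp (s * (f (x, w) - g x)) := fun w => by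
        rw [← Real.exp_add]; ring_nf
      simp_rw [h1]
      rw [integral_const_mul]
      gcongr
      refine ih (F := fun w => f (x, w)) (by fun_prop) (M := M) (fun w => hfM _) fun w i y => ?_
      have := hlip (Fin.cons x w) i.succ y
      simpa [f, Fin.cons_update] using this
    have hgE : Integrable (fun x => Real.exp (s * (g x - ∫ x, g x ∂ν))) ν :=
      integrable_exp_of_abs_le (M := |s| * (M + M)) (by fun_prop) fun x => by
        rw [abs_mul]; gcongr
        exact (abs_sub _ _).trans (add_le_add (hgM x) hgI)
    refine (integral_mono_of_nonneg (ae_of_all _ fun x => integral_nonneg fun w =>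
      (Real.exp_pos _).le) (hgE.mul_const _) (ae_of_all _ hstep)).trans ?_
    rw [integral_mul_const, pow_succ']
    gcongr
    exact integral_exp_sub_integral_le hg hgM hglip s hint

/-- Sub-Gaussian concentration of an integrable function of `n` independent `E`-valued variables
whose oscillation in each of them is at most `d`, where `d` of two independent copies has
sub-Gaussian symmetric exponential moments. The function is truncated, which preserves the bound on
its oscillations, and Fatou's lemma removes the truncation. -/
theorem hasSubgaussianMGF_pi {ν : Measure E} [IsProbabilityMeasure ν] {d : E → E → ℝ} {c : NNReal}
    (hint : ∀ s : ℝ, Integrable (fun p : E × E => Real.cosh (s * d p.1 p.2)) (ν.prod ν))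
    (hc : ∀ s : ℝ, ∫ p, Real.cosh (s * d p.1 p.2) ∂(ν.prod ν) ≤ Real.exp (c * s ^ 2 / 2))
    {n : ℕ} {F : (Fin n → E) → ℝ} (hF : Measurable F) (hFi : Integrable F (Measure.pi fun _ => ν))
    (hlip : ∀ w i y, |F (Function.update w i y) - F w| ≤ d y (w i)) :
    HasSubgaussianMGF (fun w => F w - ∫ w', F w' ∂(Measure.pi fun _ => ν)) (n * c)
      (Measure.pi fun _ => ν) := by
  set π := Measure.pi (fun _ : Fin n => ν) with hπ
  let T : ℕ → (Fin n → E) → ℝ := fun k w => max (-(k : ℝ)) (min (k : ℝ) (F w))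
  have hT : ∀ k, Measurable (T k) := fun k => by fun_prop
  have hTF : ∀ k w, |T k w| ≤ |F w| := fun k w => by
    have hk : (0 : ℝ) ≤ k := Nat.cast_nonneg k
    simp only [T, abs_le]
    constructor
    · rcases le_total (k : ℝ) (F w) with h | h
      · rw [min_eq_left h]
        exact le_max_of_le_right ((neg_nonpos.2 (abs_nonneg _)).trans hk)
      · rw [min_eq_right h]
        exact le_max_of_le_right (neg_abs_le _)
    · exact max_le ((neg_nonpos.2 hk).trans (abs_nonneg _))
        ((min_le_right _ _).trans (le_abs_self _))
  have hTk : ∀ k w, |T k w| ≤ k := fun k w => by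
    have hk : (0 : ℝ) ≤ k := Nat.cast_nonneg k
    exact abs_le.2 ⟨le_max_left _ _, max_le (by linarith) (min_le_left _ _)⟩
  have hTlip : ∀ k w i y, |T k (Function.update w i y) - T k w| ≤ d y (w i) := fun k w i y => by
    refine le_trans ?_ (hlip w i y)
    refine (abs_max_sub_max_le_max _ _ _ _).trans ?_
    refine max_le (by simp) ((abs_min_sub_min_le_max _ _ _ _).trans (max_le (by simp) le_rfl))
  have hTlim : ∀ w, Tendsto (fun k => T k w) atTop (𝓝 (F w)) := fun w => by
    obtain ⟨N, hN⟩ := exists_nat_ge |F w|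
    refine tendsto_const_nhds.congr' ?_
    filter_upwards [eventually_ge_atTop N] with k hk
    have hk' : |F w| ≤ k := hN.trans (by exact_mod_cast hk)
    rw [abs_le] at hk'
    simp only [T]
    rw [min_eq_right hk'.2, max_eq_right hk'.1]
  have hTI : Tendsto (fun k => ∫ w, T k w ∂π) atTop (𝓝 (∫ w, F w ∂π)) :=
    tendsto_integral_of_dominated_convergence (fun w => |F w|)
      (fun k => (hT k).aestronglyMeasurable) hFi.abs
      (fun k => ae_of_all _ fun w => by simpa using hTF k w) (ae_of_all _ hTlim)
  have key : ∀ s : ℝ, ∫⁻ w, ENNReal.ofReal (Real.exp (s * (F w - ∫ w', F w' ∂π))) ∂π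
      ≤ ENNReal.ofReal (Real.exp ((n * c : NNReal) * s ^ 2 / 2)) := fun s => by
    have hlim : ∀ w, Tendsto
        (fun k => ENNReal.ofReal (Real.exp (s * (T k w - ∫ w', T k w' ∂π)))) atTop
        (𝓝 (ENNReal.ofReal (Real.exp (s * (F w - ∫ w', F w' ∂π))))) := fun w =>
      ENNReal.tendsto_ofReal ((Real.continuous_exp.tendsto _).comp
        (((hTlim w).sub hTI).const_mul s))
    calc ∫⁻ w, ENNReal.ofReal (Real.exp (s * (F w - ∫ w', F w' ∂π))) ∂π
        = ∫⁻ w, liminf (fun k => ENNReal.ofReal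
            (Real.exp (s * (T k w - ∫ w', T k w' ∂π)))) atTop ∂π :=
          lintegral_congr fun w => (hlim w).liminf_eq.symm
      _ ≤ liminf (fun k => ∫⁻ w, ENNReal.ofReal
            (Real.exp (s * (T k w - ∫ w', T k w' ∂π))) ∂π) atTop :=
          lintegral_liminf_le fun k => by fun_prop
      _ ≤ ENNReal.ofReal (Real.exp ((n * c : NNReal) * s ^ 2 / 2)) := by
          refine (liminf_le_liminf (Eventually.of_forall fun k => ?_)).trans (liminf_const _).le
          have hTi : |∫ w, T k w ∂π| ≤ k := by
            have := norm_integral_le_of_norm_le_const (μ := π) (f := T k) (C := k)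
              (ae_of_all _ (hTk k))
            simpa using this
          rw [← ofReal_integral_eq_lintegral_ofReal
            (integrable_exp_of_abs_le (M := |s| * (k + k)) (by fun_prop) fun w => by
              rw [abs_mul]; gcongr
              exact (abs_sub _ _).trans (add_le_add (hTk k w) hTi))
            (ae_of_all _ fun w => (Real.exp_pos _).le)]
          refine ENNReal.ofReal_le_ofReal ((integral_exp_pi_le_of_bounded s (hint s) n (hT k)
            (hTk k) (hTlip k)).trans ?_)
          refine (pow_le_pow_left₀ (integral_nonneg fun p => (Real.cosh_pos _).le) (hc s)
            n).trans ?_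
          rw [← Real.exp_nat_mul]
          push_cast
          exact Real.exp_le_exp.2 (by linarith)
  have hmeas : ∀ s : ℝ, Measurable fun w => Real.exp (s * (F w - ∫ w', F w' ∂π)) := fun s => by
    fun_prop
  refine ⟨fun s => ?_, fun s => ?_⟩
  · refine ⟨(hmeas s).aestronglyMeasurable, ?_⟩
    rw [hasFiniteIntegral_iff_ofReal (ae_of_all _ fun w => (Real.exp_pos _).le)]
    exact (key s).trans_lt ENNReal.ofReal_lt_top
  · rw [mgf, integral_eq_lintegral_of_nonneg_ae (ae_of_all _ fun w => (Real.exp_pos _).le)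
      (hmeas s).aestronglyMeasurable]
    exact ENNReal.toReal_le_of_le_ofReal (Real.exp_pos _).le (key s)

end Concentration

/-! ### Maxima of Gaussian variables -/

section

theorem exp_le_one_add_add {x : ℝ} (hx : 0 ≤ x) : Real.exp x ≤ 1 + x + x ^ 2 * Real.exp x := by
  have h1 : Real.exp x - 1 ≤ x * Real.exp x := by
    have := Real.add_one_le_exp (-x)
    have h2 : Real.exp (-x) * Real.exp x = 1 := by rw [← Real.exp_add]; simp
    nlinarith [Real.exp_pos x]
  nlinarith [Real.add_one_le_exp x]

/-- The inequality of arithmetic and geometric means for `a` and `z ^ 2 / (4 * a)`. -/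
theorem le_add_sq_div {a : ℝ} (ha : 0 < a) (z : ℝ) : z ≤ a + z ^ 2 / (4 * a) := by
  rw [← sub_nonneg]
  have : a + z ^ 2 / (4 * a) - z = (2 * a - z) ^ 2 / (4 * a) := by
    field_simp; ring
  rw [this]; positivity

theorem integral_exp_mul_gaussian (v : NNReal) (s : ℝ) :
    ∫ x, Real.exp (s * x) ∂(gaussianReal 0 v) = Real.exp (v * s ^ 2 / 2) := by
  have := congrFun (mgf_id_gaussianReal (μ := 0) (v := v)) s
  simpa [mgf] using this

/-- The second-order vanishing at `s = 0` is what makes the bound in `integral_cosh_supDist_le`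
sub-Gaussian. -/
theorem gaussian_cosh_sub_one_sq (s : ℝ) :
    Integrable (fun p : ℝ × ℝ => (Real.cosh (s * |p.1 - p.2|) - 1) ^ 2)
      ((gaussianReal 0 1).prod (gaussianReal 0 1)) ∧
    ∫ p : ℝ × ℝ, (Real.cosh (s * |p.1 - p.2|) - 1) ^ 2
      ∂((gaussianReal 0 1).prod (gaussianReal 0 1)) ≤ 8 * (s ^ 2) ^ 2 * Real.exp (4 * s ^ 2) := by
  set γ := gaussianReal 0 1
  have hE : ∀ r : ℝ, Integrable (fun p : ℝ × ℝ => Real.exp (r * (p.1 - p.2))) (γ.prod γ) :=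
    fun r => by
      have := (integrable_exp_mul_gaussianReal (μ := 0) (v := 1) r).mul_prod
        (integrable_exp_mul_gaussianReal (μ := 0) (v := 1) (-r))
      refine this.congr (ae_of_all _ fun p => ?_)
      simp only
      rw [← Real.exp_add]; ring_nf
  have hI : ∀ r : ℝ, ∫ p : ℝ × ℝ, Real.exp (r * (p.1 - p.2)) ∂(γ.prod γ) = Real.exp (r ^ 2) :=
    fun r => by
      have : ∀ p : ℝ × ℝ, Real.exp (r * (p.1 - p.2)) = Real.exp (r * p.1) * Real.exp ((-r) * p.2) :=
        fun p => by rw [← Real.exp_add]; ring_nf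
      simp_rw [this]
      rw [integral_prod_mul (μ := γ) (ν := γ) (fun x => Real.exp (r * x))
        (fun x => Real.exp ((-r) * x)), integral_exp_mul_gaussian, integral_exp_mul_gaussian,
        ← Real.exp_add]
      congr 1
      push_cast
      ring
  have heq : ∀ p : ℝ × ℝ, (Real.cosh (s * |p.1 - p.2|) - 1) ^ 2
      = (Real.exp ((2 * s) * (p.1 - p.2)) + Real.exp ((-(2 * s)) * (p.1 - p.2))) / 4
        - (Real.exp (s * (p.1 - p.2)) + Real.exp ((-s) * (p.1 - p.2))) + 3 / 2 := fun p => by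
    have h1 : Real.cosh (s * |p.1 - p.2|) = Real.cosh (s * (p.1 - p.2)) := by
      rw [← Real.cosh_abs (s * |p.1 - p.2|), ← Real.cosh_abs (s * (p.1 - p.2)), abs_mul, abs_abs,
        abs_mul]
    rw [h1, Real.cosh_eq]
    set a := Real.exp (s * (p.1 - p.2)) with ha
    have hb : Real.exp (-(s * (p.1 - p.2))) = Real.exp ((-s) * (p.1 - p.2)) := by ring_nf
    rw [hb]
    set b := Real.exp ((-s) * (p.1 - p.2))
    have hab : a * b = 1 := by
      simp only [a, b, ← Real.exp_add]; simp
    have h2 : Real.exp ((2 * s) * (p.1 - p.2)) = a ^ 2 := by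
      simp only [a, ← Real.exp_nat_mul]; ring_nf
    have h3 : Real.exp ((-(2 * s)) * (p.1 - p.2)) = b ^ 2 := by
      simp only [b, ← Real.exp_nat_mul]; ring_nf
    rw [h2, h3]
    linear_combination (1 / 2 : ℝ) * hab
  simp_rw [heq]
  have i1 : Integrable (fun p : ℝ × ℝ => (Real.exp ((2 * s) * (p.1 - p.2))
      + Real.exp ((-(2 * s)) * (p.1 - p.2))) / 4) (γ.prod γ) :=
    ((hE (2 * s)).add (hE (-(2 * s)))).div_const 4
  have i2 : Integrable (fun p : ℝ × ℝ => Real.exp (s * (p.1 - p.2))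
      + Real.exp ((-s) * (p.1 - p.2))) (γ.prod γ) := (hE s).add (hE (-s))
  have i3 : Integrable (fun p : ℝ × ℝ => (Real.exp ((2 * s) * (p.1 - p.2))
      + Real.exp ((-(2 * s)) * (p.1 - p.2))) / 4 - (Real.exp (s * (p.1 - p.2))
      + Real.exp ((-s) * (p.1 - p.2)))) (γ.prod γ) := i1.sub i2
  refine ⟨(i1.sub i2).add (integrable_const _), ?_⟩
  have : ∫ p : ℝ × ℝ, ((Real.exp ((2 * s) * (p.1 - p.2)) + Real.exp ((-(2 * s)) * (p.1 - p.2))) / 4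
        - (Real.exp (s * (p.1 - p.2)) + Real.exp ((-s) * (p.1 - p.2))) + 3 / 2) ∂(γ.prod γ)
      = (Real.exp ((2 * s) ^ 2) + Real.exp ((-(2 * s)) ^ 2)) / 4
        - (Real.exp (s ^ 2) + Real.exp ((-s) ^ 2)) + 3 / 2 := by
    rw [integral_add i3 (integrable_const _), integral_sub i1 i2, integral_div,
      integral_add (hE _) (hE _), integral_add (hE _) (hE _), hI, hI, hI, hI]
    simp
  rw [this]
  have h1 := exp_le_one_add_add (x := 4 * s ^ 2) (by positivity)
  have h2 := Real.add_one_le_exp (s ^ 2)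
  have h3 : (2 * s) ^ 2 = 4 * s ^ 2 := by ring
  have h4 : (-(2 * s)) ^ 2 = 4 * s ^ 2 := by ring
  rw [h3, h4, neg_sq]
  nlinarith

variable {κ : Type*}

/-- The law of a countable family of independent standard Gaussian variables. -/
noncomputable abbrev gaussianField (κ : Type*) : Measure (κ → ℝ) :=
  Measure.infinitePi fun _ => gaussianReal 0 1

/-- The largest difference of two families over a finite index set. -/
noncomputable def supDist (S : Finset κ) (hS : S.Nonempty) (x y : κ → ℝ) : ℝ :=
  S.sup' hS fun e => |x e - y e|

theorem measurable_supDist (S : Finset κ) (hS : S.Nonempty) :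
    Measurable fun p : (κ → ℝ) × (κ → ℝ) => supDist S hS p.1 p.2 := by
  have := Finset.measurable_sup' hS (f := fun e (p : (κ → ℝ) × (κ → ℝ)) => |p.1 e - p.2 e|)
    (fun e _ => by fun_prop)
  convert this using 1
  funext p
  simp [supDist, Finset.sup'_apply]

theorem integral_prod_gaussianField_eval (e : κ) {h : ℝ × ℝ → ℝ} (hm : Measurable h) :
    (Integrable h ((gaussianReal 0 1).prod (gaussianReal 0 1)) →
      Integrable (fun p : (κ → ℝ) × (κ → ℝ) => h (p.1 e, p.2 e))
        ((gaussianField κ).prod (gaussianField κ))) ∧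
    ∫ p : (κ → ℝ) × (κ → ℝ), h (p.1 e, p.2 e) ∂((gaussianField κ).prod (gaussianField κ))
      = ∫ p, h p ∂((gaussianReal 0 1).prod (gaussianReal 0 1)) := by
  have h1 : MeasurePreserving (fun w : κ → ℝ => w e) (gaussianField κ) (gaussianReal 0 1) :=
    measurePreserving_eval_infinitePi (fun _ : κ => gaussianReal 0 1) e
  have h2 := h1.prod h1
  refine ⟨fun hi => h2.integrable_comp_of_integrable hi, ?_⟩
  rw [← h2.map_eq, integral_map h2.measurable.aemeasurable hm.aestronglyMeasurable]
  rfl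

/-- The largest of `|S|` differences of standard Gaussian variables has symmetric exponential
moments that are sub-Gaussian with a parameter of order `√|S|`. The true order is `log |S|`, but
any power of `|S|` below the first is good enough for the laws of large numbers below. -/
theorem integral_cosh_supDist_le (S : Finset κ) (hS : S.Nonempty) (s : ℝ) :
    Integrable (fun p : (κ → ℝ) × (κ → ℝ) => Real.cosh (s * supDist S hS p.1 p.2))
      ((gaussianField κ).prod (gaussianField κ)) ∧
    ∫ p : (κ → ℝ) × (κ → ℝ), Real.cosh (s * supDist S hS p.1 p.2)
      ∂((gaussianField κ).prod (gaussianField κ)) ≤ Real.exp (16 * √S.card * s ^ 2 / 2) := by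
  have hm : Measurable fun p : (κ → ℝ) × (κ → ℝ) => Real.cosh (s * supDist S hS p.1 p.2) :=
    Real.measurable_cosh.comp ((measurable_supDist S hS).const_mul s)
  rcases eq_or_ne s 0 with rfl | hs
  · simp
  have hcard : (0 : ℝ) < S.card := by exact_mod_cast hS.card_pos
  set r := √(S.card : ℝ) with hr
  have hr1 : 1 ≤ r := by
    rw [hr, Real.one_le_sqrt]
    exact_mod_cast hS.card_pos
  have hr2 : r ^ 2 = S.card := Real.sq_sqrt hcard.le
  set u := s ^ 2 with hu
  have hu0 : 0 < u := by positivity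
  have hru : 0 < r * u := mul_pos (by linarith) hu0
  let h : ℝ × ℝ → ℝ := fun p => (Real.cosh (s * |p.1 - p.2|) - 1) ^ 2
  have hhm : Measurable h := by
    have : Measurable fun p : ℝ × ℝ => Real.cosh (s * |p.1 - p.2|) :=
      Real.measurable_cosh.comp (by fun_prop)
    fun_prop
  -- The first term of `le_add_sq_div` is not summed over `S`, and the choice of `r = √|S|` balances
  -- it with the sum of the second terms.
  have hbound : ∀ p : (κ → ℝ) × (κ → ℝ), Real.cosh (s * supDist S hS p.1 p.2)
      ≤ 1 + r * u + ∑ e ∈ S, h (p.1 e, p.2 e) / (4 * (r * u)) := fun p => by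
    obtain ⟨e, he, heq⟩ := Finset.exists_mem_eq_sup' hS fun e => |p.1 e - p.2 e|
    have h1 : h (p.1 e, p.2 e) / (4 * (r * u)) ≤ ∑ e ∈ S, h (p.1 e, p.2 e) / (4 * (r * u)) :=
      Finset.single_le_sum (f := fun e => h (p.1 e, p.2 e) / (4 * (r * u)))
        (fun i _ => by positivity) he
    rw [supDist, heq]
    refine le_trans ?_ (add_le_add_right h1 _)
    simp only [h]
    set z := Real.cosh (s * |p.1 e - p.2 e|) - 1 with hz
    have hz' : Real.cosh (s * |p.1 e - p.2 e|) = z + 1 := by rw [hz]; ring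
    have := le_add_sq_div hru z
    rw [hz']; linarith
  obtain ⟨g1, g2⟩ := gaussian_cosh_sub_one_sq s
  have hi : ∀ e ∈ S, Integrable (fun p : (κ → ℝ) × (κ → ℝ) => h (p.1 e, p.2 e) / (4 * (r * u)))
      ((gaussianField κ).prod (gaussianField κ)) := fun e _ =>
    ((integral_prod_gaussianField_eval e hhm).1 g1).div_const _
  have hI : Integrable (fun p : (κ → ℝ) × (κ → ℝ) =>
      1 + r * u + ∑ e ∈ S, h (p.1 e, p.2 e) / (4 * (r * u)))
      ((gaussianField κ).prod (gaussianField κ)) :=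
    (integrable_const _).add (integrable_finsetSum _ hi)
  refine ⟨hI.mono' hm.aestronglyMeasurable (ae_of_all _ fun p => ?_), ?_⟩
  · rw [Real.norm_eq_abs, abs_of_pos (Real.cosh_pos _)]
    exact hbound p
  refine (integral_mono_of_nonneg (ae_of_all _ fun p => (Real.cosh_pos _).le) hI
    (ae_of_all _ hbound)).trans ?_
  rw [integral_add (integrable_const _) (integrable_finsetSum _ hi), integral_finsetSum _ hi]
  simp_rw [integral_div, (integral_prod_gaussianField_eval _ hhm).2]
  simp only [integral_const, probReal_univ, smul_eq_mul, one_mul, Finset.sum_const, nsmul_eq_mul]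
  have h3 : (S.card : ℝ) * ((∫ p, h p ∂((gaussianReal 0 1).prod (gaussianReal 0 1)))
      / (4 * (r * u))) ≤ 2 * r * u * Real.exp (4 * u) := by
    rw [← hr2]
    have : r ^ 2 * ((8 * u ^ 2 * Real.exp (4 * u)) / (4 * (r * u)))
        = 2 * r * u * Real.exp (4 * u) := by
      clear_value r u
      field_simp; ring
    rw [← this]
    gcongr
  have h4 : (1 : ℝ) ≤ Real.exp (4 * u) := Real.one_le_exp (by positivity)
  have h5 : Real.exp (4 * u) ≤ Real.exp (4 * (r * u)) := Real.exp_le_exp.2 (by nlinarith)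
  have h6 := Real.add_one_le_exp (4 * (r * u))
  have h7 : Real.exp (16 * r * u / 2) = Real.exp (4 * (r * u)) * Real.exp (4 * (r * u)) := by
    rw [← Real.exp_add]; ring_nf
  rw [h7]
  nlinarith [Real.exp_pos (4 * (r * u))]

end

/-! ### Directed paths as lists of steps -/

section

/-- Edges in the coordinates `(t, i, b)`: at time `t`, from the site reached by `i` up-steps, going
up if `b` is `true` and down otherwise. The site is `(2 * i - t, t)` in the original lattice. -/
abbrev Bond : Type := ℕ × ℤ × Bool

/-- The value of the path that starts from the site `(t, i)` and makes the steps in the list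
(`true` for an up-step). -/
def val (w : Bond → ℝ) : ℕ → ℤ → List Bool → ℝ
  | _, _, [] => 0
  | t, i, b :: l => w (t, i, b) + val w (t + 1) (i + b.toNat) l

theorem val_nil (w : Bond → ℝ) (t : ℕ) (i : ℤ) : val w t i [] = 0 := rfl

theorem val_cons (w : Bond → ℝ) (t : ℕ) (i : ℤ) (b : Bool) (l : List Bool) :
    val w t i (b :: l) = w (t, i, b) + val w (t + 1) (i + b.toNat) l := rfl

theorem count_true_cons (b : Bool) (l : List Bool) :
    (b :: l).count true = b.toNat + l.count true := by
  cases b <;> simp [add_comm]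

theorem val_append (w : Bond → ℝ) (l l' : List Bool) : ∀ (t : ℕ) (i : ℤ),
    val w t i (l ++ l') = val w t i l + val w (t + l.length) (i + l.count true) l' := by
  induction l with
  | nil => intro t i; simp [val_nil]
  | cons b l ih =>
    intro t i
    rw [List.cons_append, val_cons, val_cons, ih, count_true_cons, List.length_cons,
      show t + 1 + l.length = t + (l.length + 1) by ring, add_assoc, Nat.cast_add, add_assoc]

theorem val_shift (w : Bond → ℝ) (t₀ : ℕ) (i₀ : ℤ) (l : List Bool) : ∀ (t : ℕ) (i : ℤ),
    val (fun e => w (t₀ + e.1, i₀ + e.2.1, e.2.2)) t i l = val w (t₀ + t) (i₀ + i) l := by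
  induction l with
  | nil => intro t i; rfl
  | cons b l ih => intro t i; simp only [val_cons, ih, add_assoc]

/-- Reflecting the lattice exchanges up-steps and down-steps. -/
theorem val_reflect (w : Bond → ℝ) (l : List Bool) : ∀ (t : ℕ) (i : ℤ),
    val (fun e => w (e.1, e.1 - e.2.1, !e.2.2)) t i l = val w t (t - i) (l.map (!·)) := by
  induction l with
  | nil => intro t i; rfl
  | cons b l ih =>
    intro t i
    simp only [val_cons, ih, List.map_cons]
    congr 2
    cases b
    all_goals simp
    all_goals ring

theorem val_congr {w w' : Bond → ℝ} (l : List Bool) : ∀ {t : ℕ} {i : ℤ},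
    (∀ t' i' b, t ≤ t' → t' < t + l.length → i ≤ i' → i' ≤ i + l.count true → i' - i ≤ t' - t →
      w (t', i', b) = w' (t', i', b)) → val w t i l = val w' t i l := by
  induction l with
  | nil => intro t i _; rfl
  | cons b l ih =>
    intro t i h
    have hb : b.toNat ≤ 1 := Bool.toNat_le b
    rw [List.length_cons, count_true_cons] at h
    rw [val_cons, val_cons, h t i b le_rfl (by omega) le_rfl (by omega) (by omega), ih]
    intro t' i' b' h1 h2 h3 h4 h5
    exact h t' i' b' (by omega) (by omega) (by omega) (by push_cast; omega)
      (by push_cast at h5; omega)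

theorem val_add_mul (w w' : Bond → ℝ) (r : ℝ) (l : List Bool) : ∀ (t : ℕ) (i : ℤ),
    val (fun e => w e + r * w' e) t i l = val w t i l + r * val w' t i l := by
  induction l with
  | nil => intro t i; simp [val_nil]
  | cons b l ih => intro t i; rw [val_cons, val_cons, val_cons, ih]; ring

/-- A path crosses one edge at each time, so changing the weights at one time changes its value by
at most the change of one weight. -/
theorem abs_val_sub_val_le {w w' : Bond → ℝ} {T : ℕ} {lo hi : ℤ} {D : ℝ} (hD : 0 ≤ D)
    (hT : ∀ t i b, t ≠ T → w (t, i, b) = w' (t, i, b))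
    (hDT : ∀ i b, lo ≤ i → i ≤ hi → |w (T, i, b) - w' (T, i, b)| ≤ D) (l : List Bool) :
    ∀ (t : ℕ) (i : ℤ), lo ≤ i → i + l.length ≤ hi → |val w t i l - val w' t i l| ≤ D := by
  induction l with
  | nil => intro t i _ _; simpa [val_nil]
  | cons b l ih =>
    intro t i hlo hhi
    rw [List.length_cons] at hhi
    push_cast at hhi
    have hb : b.toNat ≤ 1 := Bool.toNat_le b
    rw [val_cons, val_cons]
    rcases eq_or_ne t T with rfl | ht
    · rw [val_congr (w := w) (w' := w') l fun t' i' b' h1 _ _ _ _ => hT _ _ _ (by omega)]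
      simpa using hDT i b hlo (by omega)
    · rw [hT t i b ht]
      simpa using ih (t + 1) (i + b.toNat) (by omega) (by omega)

/-- The edges of a path. -/
def bonds : ℕ → ℤ → List Bool → Finset Bond
  | _, _, [] => ∅
  | t, i, b :: l => insert (t, i, b) (bonds (t + 1) (i + b.toNat) l)

theorem le_of_mem_bonds (l : List Bool) : ∀ {t : ℕ} {i : ℤ} {e : Bond}, e ∈ bonds t i l →
    t ≤ e.1 := by
  induction l with
  | nil => intro t i e he; simp [bonds] at he
  | cons b l ih =>
    intro t i e he
    rw [bonds, Finset.mem_insert] at he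
    rcases he with rfl | he
    · exact le_rfl
    · exact (Nat.le_succ t).trans (ih he)

theorem notMem_bonds (t : ℕ) (i j : ℤ) (b : Bool) (l : List Bool) :
    (t, i, b) ∉ bonds (t + 1) j l := fun h => by
  have := le_of_mem_bonds l h
  simp at this

theorem card_bonds (l : List Bool) : ∀ (t : ℕ) (i : ℤ), (bonds t i l).card = l.length := by
  induction l with
  | nil => intro t i; rfl
  | cons b l ih =>
    intro t i
    rw [bonds, Finset.card_insert_of_notMem (notMem_bonds _ _ _ _ _), ih, List.length_cons]

theorem val_eq_sum_bonds (w : Bond → ℝ) (l : List Bool) : ∀ (t : ℕ) (i : ℤ),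
    val w t i l = ∑ e ∈ bonds t i l, w e := by
  induction l with
  | nil => intro t i; rfl
  | cons b l ih =>
    intro t i
    rw [bonds, Finset.sum_insert (notMem_bonds _ _ _ _ _), val_cons, ih]

/-- The lists of `n` steps. -/
def words (n : ℕ) : Finset (List Bool) := (Finset.univ : Finset (Fin n → Bool)).image List.ofFn

theorem mem_words {n : ℕ} {l : List Bool} : l ∈ words n ↔ l.length = n := by
  simp only [words, Finset.mem_image, Finset.mem_univ, true_and]
  constructor
  · rintro ⟨f, rfl⟩; simp
  · rintro rfl; exact ⟨l.get, List.ofFn_get l⟩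

theorem card_words_le (n : ℕ) : (words n).card ≤ 2 ^ n :=
  Finset.card_image_le.trans (by simp)

theorem words_nonempty (n : ℕ) : (words n).Nonempty :=
  ⟨List.replicate n true, mem_words.2 (by simp)⟩

/-- The lists of `n` steps of which `a` are up-steps. -/
def wordsTo (n a : ℕ) : Finset (List Bool) := (words n).filter fun l => l.count true = a

theorem mem_wordsTo {n a : ℕ} {l : List Bool} :
    l ∈ wordsTo n a ↔ l.length = n ∧ l.count true = a := by
  rw [wordsTo, Finset.mem_filter, mem_words]

theorem wordsTo_nonempty {n a : ℕ} (h : a ≤ n) : (wordsTo n a).Nonempty :=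
  ⟨List.replicate a true ++ List.replicate (n - a) false, mem_wordsTo.2 (by
    constructor
    · simp; omega
    · simp [List.count_replicate])⟩

/-- The largest value of a path from the site `(t, i)` with steps in `A`; it is `0` when `A` is
empty. -/
noncomputable def maxVal (A : Finset (List Bool)) (w : Bond → ℝ) (t : ℕ) (i : ℤ) : ℝ :=
  ⨆ l : A, val w t i l

variable {A : Finset (List Bool)}

theorem le_maxVal {l : List Bool} (hl : l ∈ A) (w : Bond → ℝ) (t : ℕ) (i : ℤ) :
    val w t i l ≤ maxVal A w t i :=
  le_ciSup (f := fun l : A => val w t i l) (Set.finite_range _).bddAbove ⟨l, hl⟩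

theorem maxVal_le (hA : A.Nonempty) {w : Bond → ℝ} {t : ℕ} {i : ℤ} {x : ℝ}
    (h : ∀ l ∈ A, val w t i l ≤ x) : maxVal A w t i ≤ x :=
  have := hA.to_subtype
  ciSup_le fun l => h l l.2

theorem exists_maxVal_eq (hA : A.Nonempty) (w : Bond → ℝ) (t : ℕ) (i : ℤ) :
    ∃ l ∈ A, maxVal A w t i = val w t i l := by
  have := hA.to_subtype
  obtain ⟨l, hl⟩ := exists_eq_ciSup_of_finite (f := fun l : A => val w t i l)
  exact ⟨l, l.2, hl.symm⟩

theorem maxVal_congr {w w' : Bond → ℝ} {t t' : ℕ} {i i' : ℤ}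
    (h : ∀ l ∈ A, val w t i l = val w' t' i' l) : maxVal A w t i = maxVal A w' t' i' :=
  iSup_congr fun l => h l l.2

theorem maxVal_shift (w : Bond → ℝ) (t₀ : ℕ) (i₀ : ℤ) :
    maxVal A (fun e => w (t₀ + e.1, i₀ + e.2.1, e.2.2)) 0 0 = maxVal A w t₀ i₀ :=
  maxVal_congr fun l _ => by rw [val_shift]; simp

theorem abs_maxVal_sub_le (hA : A.Nonempty) {w w' : Bond → ℝ} {t : ℕ} {i : ℤ} {D : ℝ}
    (h : ∀ l ∈ A, |val w t i l - val w' t i l| ≤ D) :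
    |maxVal A w t i - maxVal A w' t i| ≤ D := by
  rw [abs_sub_le_iff]
  constructor
  · rw [sub_le_iff_le_add]
    refine maxVal_le hA fun l hl => ?_
    have := (abs_sub_le_iff.1 (h l hl)).1
    linarith [le_maxVal hl w' t i]
  · rw [sub_le_iff_le_add]
    refine maxVal_le hA fun l hl => ?_
    have := (abs_sub_le_iff.1 (h l hl)).2
    linarith [le_maxVal hl w t i]

theorem measurable_val (t : ℕ) (i : ℤ) (l : List Bool) : Measurable fun w => val w t i l := by
  simp_rw [val_eq_sum_bonds]
  fun_prop

theorem measurable_maxVal (t : ℕ) (i : ℤ) : Measurable fun w => maxVal A w t i := by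
  rcases A.eq_empty_or_nonempty with rfl | hA
  · have : (fun w => maxVal ∅ w t i) = fun _ => (0 : ℝ) := by
      funext w
      rw [maxVal, Real.iSup_of_isEmpty]
    rw [this]
    exact measurable_const
  · have := Finset.measurable_sup' hA (f := fun l (w : Bond → ℝ) => val w t i l)
      (fun l _ => measurable_val t i l)
    convert this using 1
    funext w
    rw [Finset.sup'_apply]
    refine le_antisymm (maxVal_le hA fun l hl => Finset.le_sup' (fun l => val w t i l) hl)
      (Finset.sup'_le hA _ fun l hl => le_maxVal hl w t i)

end

/-! ### The Gaussian field and concentration of last passage times -/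

section

section Field

variable {κ α : Type*}

theorem measurePreserving_pullback {f : α → κ} (hf : Function.Injective f) :
    MeasurePreserving (fun (w : κ → ℝ) i => w (f i)) (gaussianField κ) (gaussianField α) :=
  ⟨by fun_prop, Measure.map_infinitePi_infinitePi_of_inj (P := fun _ : κ => gaussianReal 0 1) hf⟩

theorem measurePreserving_coord (e : κ) :
    MeasurePreserving (fun w : κ → ℝ => w e) (gaussianField κ) (gaussianReal 0 1) :=
  measurePreserving_eval_infinitePi (fun _ : κ => gaussianReal 0 1) e

theorem iIndepFun_coord (κ : Type*) :
    iIndepFun (fun (e : κ) (w : κ → ℝ) => w e) (gaussianField κ) :=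
  iIndepFun_infinitePi (P := fun _ : κ => gaussianReal 0 1) (X := fun _ x => x)
    fun _ => measurable_id

/-- The field on a product, seen as a family of independent fields. -/
theorem measurePreserving_curry (α κ : Type*) :
    MeasurePreserving (fun (w : α × κ → ℝ) i j => w (i, j)) (gaussianField (α × κ))
      (Measure.infinitePi fun _ : α => gaussianField κ) :=
  ⟨by fun_prop, Measure.infinitePi_map_curry fun _ _ => gaussianReal 0 1⟩

theorem integrable_coord (e : κ) : Integrable (fun w : κ → ℝ => w e) (gaussianField κ) := by
  have h : Integrable (id : ℝ → ℝ) (gaussianReal 0 1) :=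
    memLp_one_iff_integrable.1 (memLp_id_gaussianReal 1)
  exact (measurePreserving_coord e).integrable_comp_of_integrable h

theorem integral_coord (e : κ) : ∫ w : κ → ℝ, w e ∂(gaussianField κ) = 0 := by
  have h := (measurePreserving_coord e).map_eq
  have h2 := integral_map (μ := gaussianField κ) (φ := fun w : κ → ℝ => w e) (f := fun x : ℝ => x)
    (measurable_pi_apply e).aemeasurable (by fun_prop)
  rw [h, integral_id_gaussianReal] at h2
  exact h2.symm

theorem _root_.ProbabilityTheory.HasSubgaussianMGF.mono {Ω : Type*} {mΩ : MeasurableSpace Ω}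
    {P : Measure Ω} {X : Ω → ℝ} {c c' : NNReal} (h : HasSubgaussianMGF X c P) (hc : c ≤ c') :
    HasSubgaussianMGF X c' P :=
  ⟨h.integrable_exp_mul, fun t => (h.mgf_le t).trans (Real.exp_le_exp.2 (by
    have : (c : ℝ) ≤ c' := hc
    gcongr))⟩

theorem hasSubgaussianMGF_coord (e : κ) :
    HasSubgaussianMGF (fun w : κ → ℝ => w e) 1 (gaussianField κ) := by
  refine ⟨fun t => ?_, fun t => ?_⟩
  · exact (measurePreserving_coord e).integrable_comp_of_integrable
      (integrable_exp_mul_gaussianReal (μ := 0) (v := 1) t)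
  · rw [mgf_gaussianReal (measurePreserving_coord e).map_eq]
    simp

theorem hasSubgaussianMGF_linear (S : Finset κ) (θ : κ → ℝ) {c : NNReal}
    (hc : ∑ e ∈ S, θ e ^ 2 ≤ c) :
    HasSubgaussianMGF (fun w : κ → ℝ => ∑ e ∈ S, θ e * w e) c (gaussianField κ) := by
  have hind : iIndepFun (fun (e : κ) (w : κ → ℝ) => θ e * w e) (gaussianField κ) :=
    iIndepFun_infinitePi (P := fun _ : κ => gaussianReal 0 1) (X := fun e x => θ e * x)
      fun _ => by fun_prop
  have := HasSubgaussianMGF.sum_of_iIndepFun hind (s := S)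
    (c := fun e => ⟨θ e ^ 2, sq_nonneg _⟩ * 1)
    fun e _ => (hasSubgaussianMGF_coord e).const_mul (θ e)
  refine this.mono ?_
  rw [← NNReal.coe_le_coe]
  rw [NNReal.coe_sum]
  exact (Finset.sum_congr rfl fun e _ => mul_one (θ e ^ 2)).le.trans hc

end Field

theorem integrable_val (t : ℕ) (i : ℤ) (l : List Bool) :
    Integrable (fun w => val w t i l) (gaussianField Bond) := by
  simp_rw [val_eq_sum_bonds]
  exact integrable_finsetSum _ fun e _ => integrable_coord e

theorem integral_val (t : ℕ) (i : ℤ) (l : List Bool) :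
    ∫ w, val w t i l ∂(gaussianField Bond) = 0 := by
  simp_rw [val_eq_sum_bonds]
  rw [integral_finsetSum _ fun e _ => integrable_coord e]
  simp [integral_coord]

theorem hasSubgaussianMGF_val (t : ℕ) (i : ℤ) (l : List Bool) :
    HasSubgaussianMGF (fun w => val w t i l) l.length (gaussianField Bond) := by
  have := hasSubgaussianMGF_linear (bonds t i l) (fun _ => 1) (c := l.length)
    (by simp [card_bonds])
  simpa [val_eq_sum_bonds] using this

variable {A : Finset (List Bool)}

theorem integrable_maxVal (A : Finset (List Bool)) (t : ℕ) (i : ℤ) :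
    Integrable (fun w => maxVal A w t i) (gaussianField Bond) := by
  rcases A.eq_empty_or_nonempty with rfl | hA
  · simp [maxVal, Real.iSup_of_isEmpty]
  refine (integrable_finsetSum A fun l _ => (integrable_val t i l).abs).mono'
    (measurable_maxVal t i).aestronglyMeasurable (ae_of_all _ fun w => ?_)
  obtain ⟨l, hl, h⟩ := exists_maxVal_eq hA w t i
  rw [h, Real.norm_eq_abs]
  exact Finset.single_le_sum (f := fun l => |val w t i l|) (fun l _ => abs_nonneg _) hl

/-- The expectation of `maxVal A`; it does not depend on the starting site. -/
noncomputable def mean (A : Finset (List Bool)) : ℝ :=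
  ∫ w, maxVal A w 0 0 ∂(gaussianField Bond)

theorem measurePreserving_shift (t : ℕ) (i : ℤ) :
    MeasurePreserving (fun (w : Bond → ℝ) (e : Bond) => w (t + e.1, i + e.2.1, e.2.2))
      (gaussianField Bond) (gaussianField Bond) :=
  measurePreserving_pullback (f := fun e : Bond => ((t + e.1, i + e.2.1, e.2.2) : Bond))
    fun e e' h => by
      simp only [Prod.mk.injEq, add_right_inj] at h
      exact Prod.ext h.1 (Prod.ext h.2.1 h.2.2)

theorem measurePreserving_reflect :
    MeasurePreserving (fun (w : Bond → ℝ) (e : Bond) => w (e.1, e.1 - e.2.1, !e.2.2))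
      (gaussianField Bond) (gaussianField Bond) :=
  measurePreserving_pullback (f := fun e : Bond => ((e.1, e.1 - e.2.1, !e.2.2) : Bond))
    fun e e' h => by
      simp only [Prod.mk.injEq, Bool.not_inj_iff] at h
      obtain ⟨h1, h2, h3⟩ := h
      exact Prod.ext h1 (Prod.ext (by omega) h3)

theorem integral_comp_of_measurePreserving {Ω Ω' : Type*} [MeasurableSpace Ω]
    [MeasurableSpace Ω'] {P : Measure Ω} {P' : Measure Ω'} {f : Ω → Ω'}
    (hf : MeasurePreserving f P P') {h : Ω' → ℝ} (hh : Measurable h) :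
    ∫ x, h (f x) ∂P = ∫ y, h y ∂P' := by
  rw [← hf.map_eq, integral_map hf.measurable.aemeasurable hh.aestronglyMeasurable]

theorem integral_maxVal (A : Finset (List Bool)) (t : ℕ) (i : ℤ) :
    ∫ w, maxVal A w t i ∂(gaussianField Bond) = mean A := by
  rw [mean, ← integral_comp_of_measurePreserving (measurePreserving_shift t i)
    (measurable_maxVal 0 0)]
  simp_rw [maxVal_shift]

/-- The sub-Gaussian parameter of the concentration of maxima over paths with `n` steps. It is of
order `n ^ (3 / 2)`, which is what matters: it is negligible against `n ^ 2 / log n`. -/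
noncomputable def fluct (n : ℕ) : NNReal := n * (16 * NNReal.sqrt (2 * (n + 1)))

/-- Reading the weights of `n` successive times from `r`. -/
def extend {n : ℕ} (r : Fin n → ℤ × Bool → ℝ) (e : Bond) : ℝ :=
  if h : e.1 < n then r ⟨e.1, h⟩ e.2 else 0

theorem measurable_extend (n : ℕ) : Measurable (extend (n := n)) := by
  refine measurable_pi_iff.2 fun e => ?_
  by_cases h : e.1 < n
  · simp only [extend, h, dite_true]; fun_prop
  · simp only [extend, h, dite_false]; fun_prop

/-- Concentration of last passage times. The independent variables to which `hasSubgaussianMGF_pi`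
applies are the whole rows of weights at a given time, of which a path uses one entry. -/
theorem hasSubgaussianMGF_maxVal {n : ℕ} (hA : A.Nonempty) (hn : A ⊆ words n) (t : ℕ) (i : ℤ) :
    HasSubgaussianMGF (fun w => maxVal A w t i - mean A) (fluct n) (gaussianField Bond) := by
  let ν := gaussianField (ℤ × Bool)
  let R : (Bond → ℝ) → Fin n → ℤ × Bool → ℝ := fun w k e => w (t + k, i + e.1, e.2)
  have hR : MeasurePreserving R (gaussianField Bond) (Measure.pi fun _ : Fin n => ν) := by
    have h1 := measurePreserving_pullback (κ := Bond)
      (f := fun p : Fin n × (ℤ × Bool) => ((t + p.1, i + p.2.1, p.2.2) : Bond)) fun p p' h => by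
        simp only [Prod.mk.injEq, add_right_inj, Fin.val_inj] at h
        exact Prod.ext h.1 (Prod.ext h.2.1 h.2.2)
    have h2 := (measurePreserving_curry (Fin n) (ℤ × Bool)).comp h1
    rw [Measure.infinitePi_eq_pi] at h2
    exact h2
  have hlen : ∀ l ∈ A, l.length = n := fun l hl => mem_words.1 (hn hl)
  let F : (Fin n → ℤ × Bool → ℝ) → ℝ := fun r => maxVal A (extend r) 0 0
  have hF : Measurable F := (measurable_maxVal 0 0).comp (measurable_extend n)
  have hFR : ∀ w, F (R w) = maxVal A w t i := fun w => by
    rw [← maxVal_shift w t i]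
    refine maxVal_congr fun l hl => val_congr l fun t' i' b h1 h2 h3 h4 _ => ?_
    rw [hlen l hl] at h2
    have h5 : t' < n := by omega
    simp [extend, R, h5]
  have hmean : ∫ r, F r ∂(Measure.pi fun _ : Fin n => ν) = mean A := by
    rw [← integral_comp_of_measurePreserving hR hF]
    simp_rw [hFR]
    exact integral_maxVal A t i
  have hFi : Integrable F (Measure.pi fun _ : Fin n => ν) := by
    rw [← hR.integrable_comp hF.aestronglyMeasurable]
    exact (integrable_maxVal A t i).congr (ae_of_all _ fun w => (hFR w).symm)
  let S : Finset (ℤ × Bool) := Finset.Icc (0 : ℤ) n ×ˢ Finset.univ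
  have hS : S.Nonempty := ⟨(0, true), by simp [S]⟩
  have hcard : (S.card : ℝ) = 2 * (n + 1) := by
    simp [S, Finset.card_product]
    ring
  have hlip : ∀ r k y, |F (Function.update r k y) - F r| ≤ supDist S hS y (r k) := fun r k y => by
    have hle : ∀ e ∈ S, |y e - r k e| ≤ supDist S hS y (r k) := fun e he =>
      Finset.le_sup' (fun e => |y e - r k e|) he
    refine abs_maxVal_sub_le hA fun l hl => ?_
    refine abs_val_sub_val_le (T := k) (lo := 0) (hi := n)
      ((abs_nonneg _).trans (hle (0, true) (by simp [S]))) (fun t' i' b ht => ?_)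
      (fun i' b h1 h2 => ?_) l 0 0 le_rfl (by rw [hlen l hl]; simp)
    · by_cases h : t' < n
      · have : (⟨t', h⟩ : Fin n) ≠ k := fun h' => ht (by rw [← h'])
        simp [extend, h, this]
      · simp [extend, h]
    · have := hle (i', b) (by simp [S, h1, h2])
      simpa [extend] using this
  have hc := fun s => integral_cosh_supDist_le S hS s
  have hsub := hasSubgaussianMGF_pi (ν := ν) (d := supDist S hS)
    (c := 16 * NNReal.sqrt (2 * (n + 1)))
    (fun s => (hc s).1) (fun s => by
      have := (hc s).2
      rw [hcard] at this
      push_cast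
      exact this) hF hFi hlip
  rw [hmean] at hsub
  have := HasSubgaussianMGF.of_map (μ := gaussianField Bond) (Y := R)
    hR.measurable.aemeasurable (by rw [hR.map_eq]; exact hsub)
  simpa [Function.comp_def, hFR, fluct] using this

/-- Maxima of exponentials are at most their sums: the expected maximum of `N` variables with
exponential moment `exp C` exceeds their level by at most `log N + C`. -/
theorem integral_le_of_exp_le_sum {Ω : Type*} [MeasurableSpace Ω] {P : Measure Ω}
    [IsProbabilityMeasure P] {ι : Type*} {S : Finset ι} {Y : ι → Ω → ℝ} {X : Ω → ℝ}
    (hX : Integrable X P) (hS : 0 < S.card)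
    (hY : ∀ a ∈ S, Integrable (fun ω => Real.exp (Y a ω)) P) {C : ℝ}
    (hC : ∀ a ∈ S, ∫ ω, Real.exp (Y a ω) ∂P ≤ Real.exp C)
    (h : ∀ ω, ∃ a ∈ S, X ω ≤ Y a ω) : ∫ ω, X ω ∂P ≤ Real.log S.card + C := by
  have hsum : Integrable (fun ω => ∑ a ∈ S, Real.exp (Y a ω)) P := integrable_finsetSum _ hY
  have hle : ∀ ω, Real.exp (X ω) ≤ ∑ a ∈ S, Real.exp (Y a ω) := fun ω => by
    obtain ⟨a, ha, h1⟩ := h ω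
    exact (Real.exp_le_exp.2 h1).trans
      (Finset.single_le_sum (f := fun a => Real.exp (Y a ω)) (fun _ _ => (Real.exp_pos _).le) ha)
  have hXe : Integrable (fun ω => Real.exp (X ω)) P :=
    hsum.mono' (Real.continuous_exp.comp_aestronglyMeasurable hX.1) (ae_of_all _ fun ω => by
      rw [Real.norm_eq_abs, abs_of_pos (Real.exp_pos _)]; exact hle ω)
  have hJ : Real.exp (∫ ω, X ω ∂P) ≤ ∫ ω, Real.exp (X ω) ∂P := by
    simpa using convexOn_exp.map_integral_le (μ := P) (f := X)
      Real.continuous_exp.continuousOn isClosed_univ (by simp) hX hXe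
  have hcard : (0 : ℝ) < S.card := by exact_mod_cast hS
  rw [← Real.exp_le_exp, Real.exp_add, Real.exp_log hcard]
  calc Real.exp (∫ ω, X ω ∂P) ≤ ∫ ω, ∑ a ∈ S, Real.exp (Y a ω) ∂P :=
        hJ.trans (integral_mono hXe hsum hle)
    _ = ∑ a ∈ S, ∫ ω, Real.exp (Y a ω) ∂P := integral_finsetSum _ hY
    _ ≤ ∑ a ∈ S, Real.exp C := Finset.sum_le_sum hC
    _ = S.card * Real.exp C := by simp

theorem mean_words_le (n : ℕ) : mean (words n) ≤ 2 * n := by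
  have h := integral_le_of_exp_le_sum (P := gaussianField Bond) (S := words n)
    (Y := fun l w => val w 0 0 l) (X := fun w => maxVal (words n) w 0 0) (C := n / 2)
    (integrable_maxVal _ 0 0) (words_nonempty n).card_pos
    (fun l _ => by simpa using (hasSubgaussianMGF_val 0 0 l).integrable_exp_mul 1)
    (fun l hl => by
      have := (hasSubgaussianMGF_val 0 0 l).mgf_le 1
      rw [mem_words] at hl
      simpa [mgf, hl] using this)
    (fun w => by
      obtain ⟨l, hl, h⟩ := exists_maxVal_eq (words_nonempty n) w 0 0
      exact ⟨l, hl, h.le⟩)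
  have h1 : Real.log (words n).card ≤ n * Real.log 2 := by
    rw [← Real.log_pow]
    refine Real.log_le_log (by exact_mod_cast (words_nonempty n).card_pos) ?_
    exact_mod_cast card_words_le n
  have h2 := Real.log_two_lt_d9
  have h3 : (0 : ℝ) ≤ n := Nat.cast_nonneg n
  have h4 : (n : ℝ) * Real.log 2 ≤ n * 1 := by gcongr; linarith
  rw [mean]
  linarith

end

/-! ### The time constant and the law of large numbers -/

theorem maxVal_add_le {A B C : Finset (List Bool)} (hA : A.Nonempty) (hB : B.Nonempty) {m a : ℕ}
    (hAm : A ⊆ wordsTo m a) (h : ∀ l ∈ A, ∀ l' ∈ B, l ++ l' ∈ C) (w : Bond → ℝ) (t : ℕ) (i : ℤ) :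
    maxVal A w t i + maxVal B w (t + m) (i + a) ≤ maxVal C w t i := by
  obtain ⟨l, hl, h1⟩ := exists_maxVal_eq hA w t i
  obtain ⟨l', hl', h2⟩ := exists_maxVal_eq hB w (t + m) (i + a)
  obtain ⟨h3, h4⟩ := mem_wordsTo.1 (hAm hl)
  have := le_maxVal (h l hl l' hl') w t i
  rwa [val_append, h3, h4, ← h1, ← h2] at this

theorem mean_add_le {A B C : Finset (List Bool)} (hA : A.Nonempty) (hB : B.Nonempty) {m a : ℕ}
    (hAm : A ⊆ wordsTo m a) (h : ∀ l ∈ A, ∀ l' ∈ B, l ++ l' ∈ C) : mean A + mean B ≤ mean C := by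
  have h1 : mean A + mean B
      = ∫ w, (maxVal A w 0 0 + maxVal B w (0 + m) (0 + a)) ∂(gaussianField Bond) := by
    rw [integral_add (integrable_maxVal _ _ _) (integrable_maxVal _ _ _), integral_maxVal,
      integral_maxVal]
  rw [h1]
  exact integral_mono ((integrable_maxVal _ _ _).add (integrable_maxVal _ _ _))
    (integrable_maxVal _ _ _) fun w => maxVal_add_le hA hB hAm h w 0 0

theorem append_mem_wordsTo {m n a b : ℕ} {l l' : List Bool} (hl : l ∈ wordsTo m a)
    (hl' : l' ∈ wordsTo n b) : l ++ l' ∈ wordsTo (m + n) (a + b) := by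
  rw [mem_wordsTo] at *
  simp [hl.1, hl.2, hl'.1, hl'.2]

theorem count_true_map_not (l : List Bool) : (l.map (!·)).count true + l.count true = l.length := by
  induction l with
  | nil => rfl
  | cons b l ih =>
    rw [List.map_cons, count_true_cons, count_true_cons, List.length_cons]
    cases b <;> simp <;> omega

theorem mean_wordsTo_le_reflect {n a : ℕ} (h : a ≤ n) :
    mean (wordsTo n a) ≤ mean (wordsTo n (n - a)) := by
  have h1 := integral_comp_of_measurePreserving measurePreserving_reflect
    (measurable_maxVal (A := wordsTo n a) 0 0)
  rw [mean, ← h1]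
  refine integral_mono (measurePreserving_reflect.integrable_comp_of_integrable
    (integrable_maxVal _ 0 0)) (integrable_maxVal _ 0 0) fun w => ?_
  refine maxVal_le (wordsTo_nonempty h) fun l hl => ?_
  rw [mem_wordsTo] at hl
  rw [val_reflect]
  refine le_maxVal (l := l.map (!·)) (mem_wordsTo.2 ⟨by simp [hl.1], ?_⟩) w 0 0
  have := count_true_map_not l
  omega

/-- The expected last passage time from the origin straight ahead to time `2 * k`. -/
noncomputable def meanStraight (k : ℕ) : ℝ := mean (wordsTo (2 * k) k)

/-- A path to `(n, a)` and a path that makes `n - a` further up-steps out of `n` lead straight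
ahead; by reflection both have the same expected maximum. -/
theorem two_mul_mean_wordsTo_le {n a : ℕ} (h : a ≤ n) :
    2 * mean (wordsTo n a) ≤ meanStraight n := by
  have h1 : mean (wordsTo n a) + mean (wordsTo n (n - a)) ≤ meanStraight n := by
    refine mean_add_le (wordsTo_nonempty h) (wordsTo_nonempty (Nat.sub_le n a)) subset_rfl
      fun l hl l' hl' => ?_
    have := append_mem_wordsTo hl hl'
    rwa [← two_mul, Nat.add_sub_cancel' h] at this
  linarith [mean_wordsTo_le_reflect h]

theorem meanStraight_add_le (j k : ℕ) :
    meanStraight j + meanStraight k ≤ meanStraight (j + k) := by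
  refine mean_add_le (wordsTo_nonempty (by omega)) (wordsTo_nonempty (by omega)) subset_rfl
    fun l hl l' hl' => ?_
  rw [mul_add]
  exact append_mem_wordsTo hl hl'

theorem meanStraight_div_two_le_mean_words (n : ℕ) :
    meanStraight (n / 2) ≤ mean (words n) := by
  have h1 : mean {List.replicate (n % 2) true} = 0 := by
    rw [mean, ← integral_val 0 0 (List.replicate (n % 2) true)]
    refine integral_congr_ae (ae_of_all _ fun w => ?_)
    obtain ⟨l, hl, h⟩ := exists_maxVal_eq (Finset.singleton_nonempty
      (List.replicate (n % 2) true)) w 0 0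
    rw [Finset.mem_singleton] at hl
    rw [hl] at h
    exact h
  have h2 : mean (wordsTo (2 * (n / 2)) (n / 2)) + mean {List.replicate (n % 2) true}
      ≤ mean (words n) := by
    refine mean_add_le (wordsTo_nonempty (by omega)) (Finset.singleton_nonempty _) subset_rfl
      fun l hl l' hl' => ?_
    rw [Finset.mem_singleton] at hl'
    rw [mem_wordsTo] at hl
    rw [mem_words, List.length_append, hl', hl.1, List.length_replicate]
    omega
  rw [meanStraight]
  linarith

theorem meanStraight_le (k : ℕ) : meanStraight k ≤ 4 * k := by
  have h1 := meanStraight_div_two_le_mean_words (2 * k)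
  have h2 := mean_words_le (2 * k)
  rw [Nat.mul_div_cancel_left k two_pos] at h1
  push_cast at h2
  linarith

theorem subadditive_neg_meanStraight : Subadditive fun k => -meanStraight k := fun j k => by
  linarith [meanStraight_add_le j k]

theorem bddBelow_neg_meanStraight :
    BddBelow (Set.range fun k : ℕ => -meanStraight k / (k : ℝ)) := by
  refine ⟨-4, ?_⟩
  rintro _ ⟨k, rfl⟩
  rcases Nat.eq_zero_or_pos k with rfl | hk
  · simp
  have hk' : (0 : ℝ) < k := by exact_mod_cast hk
  simp only
  rw [le_div_iff₀ hk']
  linarith [meanStraight_le k]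

/-- The time constant, half the limit of `meanStraight k / k` because `meanStraight k` is about
paths with `2 * k` steps. The sign is that of Fekete's lemma, which is stated for subadditive
sequences. -/
noncomputable def timeConst : ℝ := -subadditive_neg_meanStraight.lim / 2

theorem tendsto_meanStraight_div :
    Tendsto (fun k : ℕ => meanStraight k / (k : ℝ)) atTop (𝓝 (2 * timeConst)) := by
  have := (subadditive_neg_meanStraight.tendsto_lim bddBelow_neg_meanStraight).neg
  convert this using 1
  · funext k; ring
  · rw [timeConst]; ring_nf

theorem meanStraight_le_timeConst (k : ℕ) : meanStraight k ≤ 2 * timeConst * k := by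
  rcases Nat.eq_zero_or_pos k with rfl | hk
  · simpa using meanStraight_le 0
  have h := subadditive_neg_meanStraight.lim_le_div bddBelow_neg_meanStraight hk.ne'
  have hk' : (0 : ℝ) < k := by exact_mod_cast hk
  rw [le_div_iff₀ hk'] at h
  rw [timeConst]
  linarith

/-- The endpoint of the longest path is one of `n + 1` sites, and concentration makes its randomness
cost little; the reflection argument in `two_mul_mean_wordsTo_le` then compares any endpoint with
the one straight ahead. -/
theorem mean_words_le_meanStraight {n : ℕ} {s : ℝ} (hs : 0 < s) :
    mean (words n) ≤ meanStraight n / 2 + Real.log (n + 1) / s + fluct n * s / 2 := by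
  have hsub : ∀ a ∈ Finset.range (n + 1), HasSubgaussianMGF
      (fun w => maxVal (wordsTo n a) w 0 0 - mean (wordsTo n a)) (fluct n) (gaussianField Bond) :=
    fun a ha => hasSubgaussianMGF_maxVal (wordsTo_nonempty (by simpa [Nat.lt_succ_iff] using ha))
      (Finset.filter_subset _ _) 0 0
  have hint := integrable_maxVal (words n) 0 0
  have h := integral_le_of_exp_le_sum (P := gaussianField Bond) (S := Finset.range (n + 1))
    (Y := fun a w => s * (maxVal (wordsTo n a) w 0 0 - mean (wordsTo n a)))
    (X := fun w => s * (maxVal (words n) w 0 0 - meanStraight n / 2)) (C := fluct n * s ^ 2 / 2)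
    ((hint.sub (integrable_const _)).const_mul s) (by simp)
    (fun a ha => (hsub a ha).integrable_exp_mul s) (fun a ha => (hsub a ha).mgf_le s)
    (fun w => by
      obtain ⟨l, hl, h⟩ := exists_maxVal_eq (words_nonempty n) w 0 0
      rw [mem_words] at hl
      have hc : l.count true ≤ n := hl ▸ List.count_le_length
      refine ⟨l.count true, by simpa [Nat.lt_succ_iff] using hc, ?_⟩
      have h1 := le_maxVal (mem_wordsTo.2 ⟨hl, rfl⟩) w 0 0
      have h2 := two_mul_mean_wordsTo_le hc
      refine mul_le_mul_of_nonneg_left ?_ hs.le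
      linarith)
  rw [integral_const_mul, integral_sub hint (integrable_const _)] at h
  simp only [integral_const, probReal_univ, smul_eq_mul, one_mul, Finset.card_range] at h
  push_cast at h
  have h3 : mean (words n) - meanStraight n / 2
      ≤ (Real.log (n + 1) + fluct n * s ^ 2 / 2) / s := by
    rw [le_div_iff₀ hs, mul_comm]
    exact h
  have h4 : (Real.log (n + 1) + fluct n * s ^ 2 / 2) / s
      = Real.log (n + 1) / s + fluct n * s / 2 := by
    field_simp
  linarith

theorem fluct_pos {n : ℕ} (hn : 0 < n) : (0 : ℝ) < fluct n := by
  have : (0 : NNReal) < fluct n := by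
    rw [fluct]
    have : (0 : NNReal) < n := by exact_mod_cast hn
    positivity
  exact_mod_cast this

/-- The fluctuations are small enough both for a union over polynomially many endpoints and for the
Borel–Cantelli lemma. -/
theorem tendsto_fluct_mul_log :
    Tendsto (fun n : ℕ => fluct n * Real.log (n + 1) / (n : ℝ) ^ 2) atTop (𝓝 0) := by
  have h1 : Tendsto (fun x : ℝ => Real.log x / x ^ (1 / 2 : ℝ)) atTop (𝓝 0) :=
    (isLittleO_log_rpow_atTop (by norm_num : (0 : ℝ) < 1 / 2)).tendsto_div_nhds_zero
  have h2 : Tendsto (fun n : ℕ => (n : ℝ) + 1) atTop atTop :=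
    tendsto_natCast_atTop_atTop.atTop_add tendsto_const_nhds
  have h3 := ((h1.comp h2).const_mul 64)
  rw [mul_zero] at h3
  refine tendsto_of_tendsto_of_tendsto_of_le_of_le' tendsto_const_nhds h3
    (Eventually.of_forall fun n => ?_) ?_
  · have : 0 ≤ Real.log ((n : ℝ) + 1) := Real.log_nonneg (by linarith [n.cast_nonneg (α := ℝ)])
    positivity
  · filter_upwards [eventually_ge_atTop 1] with n hn
    have hn' : (1 : ℝ) ≤ n := by exact_mod_cast hn
    have hlog : 0 ≤ Real.log ((n : ℝ) + 1) := Real.log_nonneg (by linarith)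
    simp only [Function.comp, fluct]
    push_cast
    rw [← Real.sqrt_eq_rpow]
    set L := Real.log ((n : ℝ) + 1)
    set r := √((n : ℝ) + 1) with hr
    have hr0 : 0 < r := Real.sqrt_pos.2 (by linarith)
    have hr2 : r ^ 2 = n + 1 := Real.sq_sqrt (by linarith)
    have h5 : √(2 * ((n : ℝ) + 1)) ≤ 2 * r := by
      rw [Real.sqrt_le_left (by positivity), mul_pow, hr2]
      linarith
    calc (n : ℝ) * (16 * √(2 * ((n : ℝ) + 1))) * L / n ^ 2
        ≤ n * (16 * (2 * r)) * L / n ^ 2 := by gcongr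
      _ = 32 * (r ^ 2 / n) * (L / r) := by field_simp; ring
      _ ≤ 32 * 2 * (L / r) := by
          gcongr
          rw [hr2, div_le_iff₀ (by linarith)]
          linarith
      _ = 64 * (L / r) := by ring

theorem tendsto_mean_words_div :
    Tendsto (fun n : ℕ => mean (words n) / (n : ℝ)) atTop (𝓝 timeConst) := by
  refine tendsto_order.2 ⟨fun a ha => ?_, fun a ha => ?_⟩
  · have h1 : Tendsto (fun n : ℕ => n / 2) atTop atTop := Nat.tendsto_div_const_atTop two_ne_zero
    have h2 := tendsto_meanStraight_div.comp h1
    have h3 : Tendsto (fun n : ℕ => ((n / 2 : ℕ) : ℝ) / (n : ℝ)) atTop (𝓝 (1 / 2)) := by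
      have := tendsto_nat_floor_mul_div_atTop (R := ℝ) (a := 1 / 2) (by norm_num)
      have h4 := this.comp tendsto_natCast_atTop_atTop
      refine h4.congr fun n => ?_
      simp only [Function.comp]
      congr 2
      rw [show (1 / 2 : ℝ) * n = (n : ℝ) / (2 : ℕ) by push_cast; ring, Nat.floor_div_eq_div]
    have h5 := h2.mul h3
    have h6 : 2 * timeConst * (1 / 2) = timeConst := by ring
    rw [h6] at h5
    filter_upwards [h5.eventually (lt_mem_nhds ha), eventually_ge_atTop 2] with n hn hn2
    have hn0 : (0 : ℝ) < n := by exact_mod_cast (by omega : 0 < n)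
    have hn3 : (0 : ℝ) < (n / 2 : ℕ) := by exact_mod_cast (by omega : 0 < n / 2)
    refine hn.trans_le ?_
    simp only [Function.comp]
    rw [div_mul_div_cancel₀ hn3.ne']
    gcongr
    exact meanStraight_div_two_le_mean_words n
  · set δ := a - timeConst with hδ
    have hδ0 : 0 < δ := by linarith
    have h1 := (tendsto_fluct_mul_log.div_const δ)
    rw [zero_div] at h1
    filter_upwards [h1.eventually (gt_mem_nhds (half_pos hδ0)), eventually_ge_atTop 1] with n hn hn1
    have hn0 : (0 : ℝ) < n := by exact_mod_cast hn1
    have hf := fluct_pos hn1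
    -- This `s` makes the last term equal to `δ / 2 * n`.
    have h2 := mean_words_le_meanStraight (n := n) (s := δ * n / fluct n) (by positivity)
    have h3 := meanStraight_le_timeConst n
    rw [div_lt_iff₀ hn0]
    have h4 : (fluct n : ℝ) * (δ * n / fluct n) / 2 = δ / 2 * n := by field_simp
    have h5 : Real.log (n + 1) / (δ * n / fluct n)
        = (fluct n * Real.log (n + 1) / (n : ℝ) ^ 2 / δ) * n := by field_simp
    rw [h4, h5] at h2
    have h6 : (fluct n * Real.log (n + 1) / (n : ℝ) ^ 2 / δ) * n < δ / 2 * n := by gcongr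
    have h7 : a * n = timeConst * n + δ * n := by rw [hδ]; ring
    linarith

theorem ae_eventually_abs_maxVal_sub_le {δ : ℝ} (hδ : 0 < δ) :
    ∀ᵐ w ∂(gaussianField Bond), ∀ᶠ n : ℕ in atTop,
      |maxVal (words n) w 0 0 - mean (words n)| < δ * n := by
  set P := gaussianField Bond
  have hsub : ∀ n, HasSubgaussianMGF (fun w => maxVal (words n) w 0 0 - mean (words n))
      (fluct n) P := fun n => hasSubgaussianMGF_maxVal (words_nonempty n) subset_rfl 0 0
  let s : ℕ → Set (Bond → ℝ) := fun n => {w | δ * n ≤ |maxVal (words n) w 0 0 - mean (words n)|}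
  have hs : ∀ n, P.real (s n) ≤ 2 * Real.exp (-(δ * n) ^ 2 / (2 * fluct n)) := fun n => by
    have hn : 0 ≤ δ * n := by positivity
    have h1 := (hsub n).measure_ge_le hn
    have h2 := (hsub n).neg.measure_ge_le hn
    have h3 : s n ⊆ {w | δ * n ≤ maxVal (words n) w 0 0 - mean (words n)}
        ∪ {w | δ * n ≤ (-fun w => maxVal (words n) w 0 0 - mean (words n)) w} := fun w hw => by
      simpa [s, le_abs] using hw
    refine (measureReal_mono h3).trans ((measureReal_union_le _ _).trans ?_)
    linarith
  have hsum : Summable fun n => P.real (s n) := by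
    have hpow : Summable fun n : ℕ => 2 * (1 / ((n : ℝ) ^ 2)) :=
      (Real.summable_one_div_nat_pow.2 one_lt_two).mul_left 2
    refine Summable.of_norm_bounded_eventually_nat hpow ?_
    have h1 := tendsto_fluct_mul_log.eventually (gt_mem_nhds (show 0 < δ ^ 2 / 4 by positivity))
    filter_upwards [h1, eventually_ge_atTop 1] with n hn hn1
    rw [Real.norm_eq_abs, abs_of_nonneg measureReal_nonneg]
    refine (hs n).trans ?_
    have hn0 : (0 : ℝ) < n := by exact_mod_cast hn1
    have hf := fluct_pos hn1
    have h2 : Real.log n ≤ Real.log (n + 1) := Real.log_le_log hn0 (by linarith)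
    have h3 : 1 / (n : ℝ) ^ 2 = Real.exp (-(2 * Real.log n)) := by
      rw [Real.exp_neg, show 2 * Real.log n = ((2 : ℕ) : ℝ) * Real.log n by norm_num,
        Real.exp_nat_mul, Real.exp_log hn0, one_div]
    rw [h3]
    gcongr
    rw [neg_div, neg_le_neg_iff, le_div_iff₀ (by positivity)]
    rw [div_lt_iff₀ (by positivity)] at hn
    have h4 : fluct n * Real.log n ≤ fluct n * Real.log (n + 1) := by gcongr
    have h6 : 2 * Real.log n * (2 * fluct n) = 4 * (fluct n * Real.log n) := by ring
    have h7 : (δ * n) ^ 2 = 4 * (δ ^ 2 / 4 * n ^ 2) := by ring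
    rw [h6, h7]
    linarith
  have htop : ∑' n, P (s n) ≠ ⊤ := by
    have : ∀ n, P (s n) = ENNReal.ofReal (P.real (s n)) := fun n => by simp
    simp_rw [this]
    exact hsum.tsum_ofReal_ne_top
  filter_upwards [ae_eventually_notMem htop] with w hw
  filter_upwards [hw] with n hn
  simpa [s] using hn

theorem ae_tendsto_maxVal_words_div :
    ∀ᵐ w ∂(gaussianField Bond),
      Tendsto (fun n : ℕ => maxVal (words n) w 0 0 / (n : ℝ)) atTop (𝓝 timeConst) := by
  have h := ae_all_iff.2 fun k : ℕ =>
    ae_eventually_abs_maxVal_sub_le (δ := 1 / ((k : ℝ) + 1)) (by positivity)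
  filter_upwards [h] with w hw
  have h1 : Tendsto (fun n : ℕ => (maxVal (words n) w 0 0 - mean (words n)) / (n : ℝ)) atTop
      (𝓝 0) := by
    rw [Metric.tendsto_atTop']
    intro ε hε
    obtain ⟨k, hk⟩ := exists_nat_one_div_lt hε
    obtain ⟨N, hN⟩ := eventually_atTop.1 (hw k)
    refine ⟨N, fun n hn => ?_⟩
    have hn0 : (0 : ℝ) < n := by exact_mod_cast (by omega : 0 < n)
    rw [Real.dist_eq, sub_zero, abs_div, abs_of_pos hn0, div_lt_iff₀ hn0]
    exact (hN n hn.le).trans (by gcongr)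
  have h2 := h1.add tendsto_mean_words_div
  rw [zero_add] at h2
  refine h2.congr fun n => ?_
  ring

/-! ### The Pólya urn flow and tubes of independent blocks -/

/-- The edges at time `t` that paths from the origin can cross. -/
def level (t : ℕ) : Finset Bond :=
  (Finset.range (t + 1) ×ˢ (Finset.univ : Finset Bool)).map
    ⟨fun p => (t, (p.1 : ℤ), p.2), fun p p' h => by
      simp only [Prod.mk.injEq, Nat.cast_inj, true_and] at h
      exact Prod.ext h.1 h.2⟩

/-- The edges that paths with `n` steps from the origin can cross. -/
def cone (n : ℕ) : Finset Bond := (Finset.range n).biUnion level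

theorem mem_level {t : ℕ} {e : Bond} : e ∈ level t ↔ e.1 = t ∧ 0 ≤ e.2.1 ∧ e.2.1 ≤ t := by
  obtain ⟨t', i, b⟩ := e
  simp only [level, Finset.mem_map, Finset.mem_product, Finset.mem_range, Finset.mem_univ, and_true,
    Prod.exists]
  constructor
  · rintro ⟨j, b', h1, h2⟩
    have h3 := Prod.mk.inj h2
    have h4 := Prod.mk.inj h3.2
    have h5 := h3.1
    have h6 := h4.1
    simp only at h5 h6
    exact ⟨h5.symm, by omega, by omega⟩
  · rintro ⟨rfl, h1, h2⟩
    exact ⟨i.toNat, b, by omega, Prod.ext rfl (Prod.ext (Int.toNat_of_nonneg h1) rfl)⟩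

theorem mem_cone {n : ℕ} {e : Bond} : e ∈ cone n ↔ e.1 < n ∧ 0 ≤ e.2.1 ∧ e.2.1 ≤ e.1 := by
  simp only [cone, Finset.mem_biUnion, Finset.mem_range, mem_level]
  constructor
  · rintro ⟨t, h1, rfl, h2, h3⟩
    exact ⟨h1, h2, h3⟩
  · rintro ⟨h1, h2, h3⟩
    exact ⟨e.1, h1, rfl, h2, h3⟩

theorem sum_cone (f : Bond → ℝ) (n : ℕ) :
    ∑ e ∈ cone n, f e
      = ∑ t ∈ Finset.range n, ∑ i ∈ Finset.range (t + 1), (f (t, i, true) + f (t, i, false)) := by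
  rw [cone, Finset.sum_biUnion]
  · refine Finset.sum_congr rfl fun t _ => ?_
    rw [level, Finset.sum_map, Finset.sum_product]
    refine Finset.sum_congr rfl fun i _ => ?_
    rw [Fintype.sum_bool]
    rfl
  · intro t _ t' _ h
    refine Finset.disjoint_left.2 fun e he he' => h ?_
    rw [← (mem_level.1 he).1, ← (mem_level.1 he').1]

/-- The flow of the Pólya urn: a walk that leaves `(t, i)` upwards with probability
`(i + 1) / (t + 2)` is uniformly distributed on the `t + 1` sites at each time `t`, and this is the
probability that it crosses a given edge. -/
noncomputable def urnFlow (e : Bond) : ℝ :=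
  (if e.2.2 then (e.2.1 : ℝ) + 1 else e.1 + 1 - e.2.1) / ((e.1 + 1) * (e.1 + 2))

/-- One step of the urn walk preserves the uniform distribution, in dual form. -/
theorem sum_urn (m : ℕ) (V : ℕ → ℝ) :
    ∑ i ∈ Finset.range (m + 1), (((i : ℝ) + 1) * V (i + 1) + (m + 1 - i) * V i)
      = (m + 1) * ∑ i ∈ Finset.range (m + 2), V i := by
  have h1 : ∑ i ∈ Finset.range (m + 1), ((i : ℝ) + 1) * V (i + 1)
      = ∑ i ∈ Finset.range (m + 2), (i : ℝ) * V i := by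
    rw [Finset.sum_range_succ' _ (m + 1)]
    simp
  have h2 : ∑ i ∈ Finset.range (m + 1), ((m : ℝ) + 1 - i) * V i
      = ∑ i ∈ Finset.range (m + 2), ((m : ℝ) + 1 - i) * V i := by
    rw [Finset.sum_range_succ _ (m + 1)]
    simp
  rw [Finset.sum_add_distrib, h1, h2, ← Finset.sum_add_distrib, Finset.mul_sum]
  exact Finset.sum_congr rfl fun i _ => by ring

/-- The best path does at least as well as the average of the walk with flow `urnFlow`. -/
theorem exists_word_urnFlow_le (w : Bond → ℝ) (m : ℕ) : ∀ V : ℕ → ℝ, ∃ l ∈ words m,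
    ∑ e ∈ cone m, urnFlow e * w e + (∑ i ∈ Finset.range (m + 1), V i) / (m + 1)
      ≤ val w 0 0 l + V (l.count true) := by
  induction m with
  | zero => intro V; exact ⟨[], by simp [mem_words], by simp [cone, val_nil]⟩
  | succ m ih =>
    intro V
    have hm : (0 : ℝ) < m + 1 := by positivity
    obtain ⟨l, hl, h⟩ := ih fun i => (((i : ℝ) + 1) * (w (m, i, true) + V (i + 1))
      + (m + 1 - i) * (w (m, i, false) + V i)) / (m + 2)
    have hlen := mem_words.1 hl
    have hcount : l.count true ≤ m := hlen ▸ List.count_le_length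
    set i := l.count true with hi
    have hle : (((i : ℝ) + 1) * (w (m, i, true) + V (i + 1))
        + (m + 1 - i) * (w (m, i, false) + V i)) / (m + 2)
        ≤ max (w (m, i, true) + V (i + 1)) (w (m, i, false) + V i) := by
      have h1 : (0 : ℝ) ≤ m + 1 - i := by
        have : (i : ℝ) ≤ m := by exact_mod_cast hcount
        linarith
      rw [div_le_iff₀ (by positivity)]
      have h2 := mul_le_mul_of_nonneg_left (le_max_left (w (m, i, true) + V (i + 1))
        (w (m, i, false) + V i)) (show (0 : ℝ) ≤ i + 1 by positivity)
      have h3 := mul_le_mul_of_nonneg_left (le_max_right (w (m, i, true) + V (i + 1))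
        (w (m, i, false) + V i)) h1
      linarith
    have hsum : ∑ e ∈ cone (m + 1), urnFlow e * w e
        + (∑ i ∈ Finset.range (m + 1 + 1), V i) / (((m + 1 : ℕ) : ℝ) + 1)
        = ∑ e ∈ cone m, urnFlow e * w e + (∑ i ∈ Finset.range (m + 1),
          (((i : ℝ) + 1) * (w (m, i, true) + V (i + 1))
            + (m + 1 - i) * (w (m, i, false) + V i)) / (m + 2)) / (m + 1) := by
      have h1 : ∑ i ∈ Finset.range (m + 1), (((i : ℝ) + 1) * (w (m, i, true) + V (i + 1))
            + (m + 1 - i) * (w (m, i, false) + V i)) / (m + 2)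
          = (m + 1) * ∑ i ∈ Finset.range (m + 1), (urnFlow (m, i, true) * w (m, i, true)
            + urnFlow (m, i, false) * w (m, i, false))
            + (∑ i ∈ Finset.range (m + 1), (((i : ℝ) + 1) * V (i + 1) + (m + 1 - i) * V i))
              / (m + 2) := by
        rw [Finset.mul_sum, Finset.sum_div, ← Finset.sum_add_distrib]
        refine Finset.sum_congr rfl fun j _ => ?_
        simp only [urnFlow, if_true, Int.cast_natCast, Bool.false_eq_true, if_false]
        field_simp
        ring
      rw [h1, sum_urn, sum_cone, sum_cone, Finset.sum_range_succ _ m]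
      push_cast
      field_simp
      ring
    rw [hsum]
    rcases le_total (w (m, i, false) + V i) (w (m, i, true) + V (i + 1)) with h1 | h1
    · rw [max_eq_left h1] at hle
      refine ⟨l ++ [true], mem_words.2 (by simp [hlen]), h.trans ?_⟩
      have h2 : (l ++ [true]).count true = i + 1 := by simp [hi]
      rw [h2, val_append, hlen]
      simp only [val_cons, val_nil, ← hi, zero_add, add_zero]
      linarith
    · rw [max_eq_right h1] at hle
      refine ⟨l ++ [false], mem_words.2 (by simp [hlen]), h.trans ?_⟩
      have h2 : (l ++ [false]).count true = i := by simp [hi]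
      rw [h2, val_append, hlen]
      simp only [val_cons, val_nil, ← hi, zero_add, add_zero]
      linarith

theorem sum_urnFlow_sq_le (m : ℕ) : ∑ e ∈ cone m, urnFlow e ^ 2 ≤ harmonic m := by
  rw [sum_cone, harmonic]
  push_cast
  refine Finset.sum_le_sum fun t _ => ?_
  have ht : (0 : ℝ) < t + 1 := by positivity
  have hle : ∀ i ∈ Finset.range (t + 1), urnFlow (t, i, true) ^ 2 + urnFlow (t, i, false) ^ 2
      ≤ (((t : ℝ) + 1)⁻¹) ^ 2 := fun i hi => by
    have hi' : (i : ℝ) ≤ t := by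
      rw [Finset.mem_range] at hi
      exact_mod_cast Nat.lt_succ_iff.1 hi
    have hi0 : (0 : ℝ) ≤ i := Nat.cast_nonneg i
    simp only [urnFlow, if_true, Int.cast_natCast, Bool.false_eq_true, if_false]
    rw [div_pow, div_pow, ← add_div, inv_pow, div_le_iff₀ (by positivity), mul_pow,
      inv_mul_cancel_left₀ (by positivity)]
    nlinarith
  refine (Finset.sum_le_sum hle).trans (le_of_eq ?_)
  rw [Finset.sum_const, Finset.card_range, nsmul_eq_mul]
  push_cast
  field_simp

/-- Disjoint copies of an index set give independent copies of the field. -/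
theorem iIndepFun_copies {α β κ : Type*} {f : α × β → κ} (hf : Function.Injective f) :
    iIndepFun (fun (a : α) (w : κ → ℝ) (b : β) => w (f (a, b))) (gaussianField κ) := by
  rw [iIndepFun_iff_map_fun_eq_infinitePi_map (fun a => by fun_prop)]
  have h1 := ((measurePreserving_curry α β).comp (measurePreserving_pullback hf)).map_eq
  have h2 : ∀ a, (gaussianField κ).map (fun (w : κ → ℝ) (b : β) => w (f (a, b)))
      = gaussianField β := fun a =>
    (measurePreserving_pullback (f := fun b => f (a, b)) fun b b' h =>
      congrArg Prod.snd (hf h)).map_eq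
  simp_rw [h2]
  exact h1

theorem eq_and_eq_of_mul_add_eq {a k k' s s' : ℕ} (hs : s < a) (hs' : s' < a)
    (h : a * k + s = a * k' + s') : k = k' ∧ s = s' := by
  have h1 : (a * k + s) / a = k := by
    rw [Nat.mul_add_div (by omega), Nat.div_eq_of_lt hs, add_zero]
  have h2 : (a * k' + s') / a = k' := by
    rw [Nat.mul_add_div (by omega), Nat.div_eq_of_lt hs', add_zero]
  have h3 : k = k' := by rw [← h1, h, h2]
  subst h3
  exact ⟨rfl, by omega⟩

/-- The weights of the box that paths with `2 * K` steps going straight ahead can visit. -/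
def extendBox {K : ℕ} (r : Fin (2 * K) × Fin (K + 1) × Bool → ℝ) (e : Bond) : ℝ :=
  if h : e.1 < 2 * K ∧ e.2.1.toNat < K + 1 then r (⟨e.1, h.1⟩, ⟨e.2.1.toNat, h.2⟩, e.2.2) else 0

theorem measurable_extendBox (K : ℕ) : Measurable (extendBox (K := K)) := by
  refine measurable_pi_iff.2 fun e => ?_
  by_cases h : e.1 < 2 * K ∧ e.2.1.toNat < K + 1
  · simp only [extendBox, h, and_self, dite_true]; fun_prop
  · simp only [extendBox, h, dite_false]; fun_prop

/-- The `k`-th block of the tube that starts at the site `(m, i)`: the last passage time straight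
ahead over `2 * K` steps. -/
noncomputable def block (K m i k : ℕ) (w : Bond → ℝ) : ℝ :=
  maxVal (wordsTo (2 * K) K) w (m + 2 * K * k) ((i + K * k : ℕ) : ℤ)

/-- Blocks of tubes whose starting points differ by multiples of `K + 1` use different edges. -/
theorem iIndepFun_block (K m r : ℕ) :
    iIndepFun (fun (p : ℕ × ℕ) => block K m (r + (K + 1) * p.1) p.2) (gaussianField Bond) := by
  let f : (ℕ × ℕ) × (Fin (2 * K) × Fin (K + 1) × Bool) → Bond := fun p =>
    (m + 2 * K * p.1.2 + p.2.1,
      ((r + (K + 1) * p.1.1 + K * p.1.2 : ℕ) : ℤ) + (p.2.2.1 : ℕ), p.2.2.2)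
  have hf : Function.Injective f := by
    rintro ⟨⟨j, k⟩, ⟨s, c, b⟩⟩ ⟨⟨j', k'⟩, ⟨s', c', b'⟩⟩ h
    simp only [f, Prod.mk.injEq] at h
    obtain ⟨h1, h2, rfl⟩ := h
    obtain ⟨rfl, h3⟩ := eq_and_eq_of_mul_add_eq s.2 s'.2
      (by omega : 2 * K * k + s = 2 * K * k' + s')
    obtain ⟨rfl, h4⟩ := eq_and_eq_of_mul_add_eq c.2 c'.2
      (by omega : (K + 1) * j + c = (K + 1) * j' + c')
    rw [Fin.ext h3, Fin.ext h4]
  have h := (iIndepFun_copies hf).comp (fun _ x => maxVal (wordsTo (2 * K) K) (extendBox x) 0 0)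
    fun _ => (measurable_maxVal 0 0).comp (measurable_extendBox K)
  convert h using 2 with p
  funext w
  simp only [Function.comp, block]
  rw [← maxVal_shift w]
  refine maxVal_congr fun l hl => val_congr l fun t' i' b h1 h2 h3 h4 _ => ?_
  rw [mem_wordsTo] at hl
  rw [hl.1] at h2
  rw [hl.2] at h4
  have h5 : t' < 2 * K := by omega
  have h6 : i'.toNat < K + 1 := by omega
  have h7 : i' = (i'.toNat : ℤ) := by omega
  simp only [extendBox, h5, h6, and_self, dite_true, f]
  rw [← h7]

theorem hasSubgaussianMGF_block (K m i k : ℕ) :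
    HasSubgaussianMGF (fun w => block K m i k w - meanStraight K) (fluct (2 * K))
      (gaussianField Bond) :=
  hasSubgaussianMGF_maxVal (wordsTo_nonempty (by omega)) (Finset.filter_subset _ _) _ _

theorem sum_block_le (K m i q : ℕ) (w : Bond → ℝ) :
    ∑ k ∈ Finset.range q, block K m i k w ≤ maxVal (words (2 * K * q)) w m i := by
  have h : ∑ k ∈ Finset.range q, block K m i k w ≤ maxVal (wordsTo (2 * K * q) (K * q)) w m i := by
    induction q with
    | zero =>
      refine le_trans (le_of_eq ?_) (le_maxVal (l := []) (by simp [mem_wordsTo]) w m i)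
      simp [val_nil]
    | succ q ih =>
      rw [Finset.sum_range_succ]
      have h1 : maxVal (wordsTo (2 * K * q) (K * q)) w m i + block K m i q w
          ≤ maxVal (wordsTo (2 * K * (q + 1)) (K * (q + 1))) w m i := by
        rw [block, Nat.cast_add]
        exact maxVal_add_le (wordsTo_nonempty (by rw [mul_assoc]; omega))
          (wordsTo_nonempty (by omega)) subset_rfl
          (fun l hl l' hl' => append_mem_wordsTo hl hl') w m i
      linarith
  refine h.trans (maxVal_le (wordsTo_nonempty (by rw [mul_assoc]; omega)) fun l hl => ?_)
  exact le_maxVal (Finset.filter_subset _ _ hl) w m i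

/-- Averaging over the flow and over the tubes that continue it. -/
theorem urnFlow_add_block_le (K m q : ℕ) (w : Bond → ℝ) :
    ∑ e ∈ cone m, urnFlow e * w e
      + (∑ i ∈ Finset.range (m + 1), ∑ k ∈ Finset.range q, block K m i k w) / (m + 1)
      ≤ maxVal (words (m + 2 * K * q)) w 0 0 := by
  obtain ⟨l, hl, h⟩ := exists_word_urnFlow_le w m fun i => ∑ k ∈ Finset.range q, block K m i k w
  refine h.trans ?_
  refine (add_le_add_right (sum_block_le K m (l.count true) q w) _).trans ?_
  obtain ⟨l', hl', h'⟩ := exists_maxVal_eq (words_nonempty (2 * K * q)) w m (l.count true)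
  rw [mem_words] at hl hl'
  have := le_maxVal (l := l ++ l') (mem_words.2 (by rw [List.length_append, hl, hl'])) w 0 0
  rw [val_append, hl, zero_add, zero_add, ← h'] at this
  exact this

/-- Without independence the square roots of the parameters add up. -/
theorem _root_.ProbabilityTheory.HasSubgaussianMGF.sum_range {Ω : Type*} {mΩ : MeasurableSpace Ω}
    {P : Measure Ω} [IsProbabilityMeasure P] {X : ℕ → Ω → ℝ} {c : NNReal} {R : ℕ}
    (h : ∀ r < R, HasSubgaussianMGF (X r) c P) :
    HasSubgaussianMGF (fun ω => ∑ r ∈ Finset.range R, X r ω) (R ^ 2 * c) P := by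
  induction R with
  | zero => simp
  | succ R ih =>
    have h1 := (ih fun r hr => h r (by omega)).add (h R (by omega))
    simp_rw [Finset.sum_range_succ]
    refine h1.mono (le_of_eq ?_)
    rw [NNReal.sqrt_mul, NNReal.sqrt_sq]
    push_cast
    have : NNReal.sqrt c ^ 2 = c := NNReal.sq_sqrt c
    linear_combination ((R : NNReal) + 1) ^ 2 * this

/-- The tubes are split into `K + 1` classes according to the residue of their starting points;
within a class all the blocks are independent. -/
theorem hasSubgaussianMGF_sum_block (K m q : ℕ) :
    HasSubgaussianMGF (fun w => ∑ i ∈ Finset.range (m + 1), ∑ k ∈ Finset.range q,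
      (block K m i k w - meanStraight K))
      (((K + 1 : ℕ) : NNReal) ^ 2 * ((((m + 1) * q : ℕ) : NNReal) * fluct (2 * K)))
      (gaussianField Bond) := by
  let J : ℕ → Finset ℕ := fun r => (Finset.range (m + 1)).filter fun j => r + (K + 1) * j < m + 1
  have hclass : ∀ r < K + 1, HasSubgaussianMGF
      (fun w => ∑ p ∈ J r ×ˢ Finset.range q, (block K m (r + (K + 1) * p.1) p.2 w - meanStraight K))
      ((((m + 1) * q : ℕ) : NNReal) * fluct (2 * K)) (gaussianField Bond) := fun r _ => by
    have hind := (iIndepFun_block K m r).comp (fun _ x => x - meanStraight K) fun _ => by fun_prop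
    have := HasSubgaussianMGF.sum_of_iIndepFun hind (c := fun _ => fluct (2 * K))
      (s := J r ×ˢ Finset.range q) fun p _ => hasSubgaussianMGF_block K m _ _
    refine this.mono ?_
    rw [Finset.sum_const, nsmul_eq_mul]
    gcongr
    rw [Finset.card_product, Finset.card_range]
    gcongr
    exact (Finset.card_filter_le _ _).trans (by simp)
  refine (HasSubgaussianMGF.sum_range hclass).congr (ae_of_all _ fun w => ?_)
  simp only [Finset.sum_product]
  rw [← Finset.sum_fiberwise_of_maps_to (s := Finset.range (m + 1)) (t := Finset.range (K + 1))
    (g := fun i => i % (K + 1)) fun i _ => Finset.mem_range.2 (Nat.mod_lt _ (Nat.succ_pos K))]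
  refine Finset.sum_congr rfl fun r hr => ?_
  rw [Finset.mem_range] at hr
  refine Finset.sum_nbij' (fun j => r + (K + 1) * j) (fun i => i / (K + 1)) ?_ ?_ ?_ ?_ ?_
  · intro j hj
    simp only [J, Finset.mem_filter, Finset.mem_range] at hj ⊢
    exact ⟨hj.2, by rw [Nat.add_mul_mod_self_left, Nat.mod_eq_of_lt hr]⟩
  · intro i hi
    simp only [J, Finset.mem_filter, Finset.mem_range] at hi ⊢
    have h1 := Nat.mod_add_div i (K + 1)
    rw [hi.2] at h1
    exact ⟨(Nat.div_le_self _ _).trans_lt hi.1, by rw [h1]; exact hi.1⟩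
  · intro j _
    rw [Nat.add_mul_div_left _ _ (Nat.succ_pos K), Nat.div_eq_of_lt hr, zero_add]
  · intro i hi
    simp only [Finset.mem_filter] at hi
    have h1 := Nat.mod_add_div i (K + 1)
    rwa [hi.2] at h1
  · intro j _
    rfl

/-! ### The upper bound on the lower tail -/

/-- The excess of the average of the flow and its tubes over its expectation. Its variance is of
order `log m`, from the `1 / t` spread of the flow at time `t`. -/
theorem hasSubgaussianMGF_urnFlow_add_block (K m q : ℕ) {c : NNReal}
    (hc : 2 * (harmonic m : ℝ) + 2 * ((K + 1) ^ 2 * fluct (2 * K) * (q / (m + 1))) ≤ c) :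
    HasSubgaussianMGF (fun w => ∑ e ∈ cone m, urnFlow e * w e
      + ((m : ℝ) + 1)⁻¹ * ∑ i ∈ Finset.range (m + 1), ∑ k ∈ Finset.range q,
          (block K m i k w - meanStraight K)) c (gaussianField Bond) := by
  have hH : (0 : ℝ) ≤ harmonic m :=
    (Finset.sum_nonneg fun e _ => sq_nonneg (urnFlow e)).trans (sum_urnFlow_sq_le m)
  obtain ⟨H, hHm⟩ : ∃ H : NNReal, (H : ℝ) = harmonic m := ⟨⟨harmonic m, hH⟩, rfl⟩
  have h1 := hasSubgaussianMGF_linear (cone m) urnFlow (hHm ▸ sum_urnFlow_sq_le m)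
  obtain ⟨D, hD⟩ : ∃ D : NNReal, (D : ℝ)
      = ((m : ℝ) + 1)⁻¹ ^ 2 * ((K + 1) ^ 2 * ((m + 1) * q * fluct (2 * K))) :=
    ⟨⟨((m : ℝ) + 1)⁻¹ ^ 2 * ((K + 1) ^ 2 * ((m + 1) * q * fluct (2 * K))), by positivity⟩, rfl⟩
  have h2 := ((hasSubgaussianMGF_sum_block K m q).const_mul ((m : ℝ) + 1)⁻¹).mono (c' := D) <| by
    rw [← NNReal.coe_le_coe, hD]
    refine le_of_eq ?_
    change ((m : ℝ) + 1)⁻¹ ^ 2 * (((K + 1 : ℕ) ^ 2 * (((m + 1) * q : ℕ) * fluct (2 * K)) : NNReal) : ℝ)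
      = _
    push_cast
    rfl
  refine (h1.add h2).mono ?_
  rw [← NNReal.coe_le_coe]
  refine le_trans ?_ hc
  -- The bound `(x + y) ^ 2 ≤ 2 * (x ^ 2 + y ^ 2)`.
  refine (add_pow_le (NNReal.coe_nonneg _) (NNReal.coe_nonneg _) 2).trans (le_of_eq ?_)
  rw [← NNReal.coe_pow, ← NNReal.coe_pow, NNReal.sq_sqrt, NNReal.sq_sqrt]
  have hm : (0 : ℝ) < m + 1 := by positivity
  rw [hHm, hD]
  field_simp
  norm_num
  ring

/-- The lower tail at distance `ε * n` has probability at most `exp (-c * n ^ 2 / log n)`. -/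
theorem exists_measureReal_le_exp {ε : ℝ} (hε : 0 < ε) : ∃ c : ℝ, 0 < c ∧ ∀ᶠ n : ℕ in atTop,
    (gaussianField Bond).real {w | maxVal (words n) w 0 0 ≤ (timeConst - ε) * n}
      ≤ Real.exp (-(c * ((n : ℝ) ^ 2 / Real.log n))) := by
  set μ := timeConst with hμ
  -- Blocks of length `2 * K` are nearly optimal.
  obtain ⟨K, hK1, hK⟩ : ∃ K : ℕ, 1 ≤ K ∧ 2 * K * (μ - ε / 4) ≤ meanStraight K := by
    have h := tendsto_meanStraight_div.eventually (lt_mem_nhds (show 2 * (μ - ε / 4) < 2 * μ by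
      linarith))
    obtain ⟨K, h1, h2⟩ := (h.and (eventually_ge_atTop 1)).exists
    have hK0 : (0 : ℝ) < K := by exact_mod_cast h2
    rw [lt_div_iff₀ hK0] at h1
    exact ⟨K, h2, by linarith⟩
  -- The flow occupies a fraction `1 / N` of the time, so that its steps cost at most `ε / 4 * n`.
  obtain ⟨N, hN1, hN⟩ : ∃ N : ℕ, 1 ≤ N ∧ |μ| / N ≤ ε / 4 := by
    obtain ⟨N, hN⟩ := exists_nat_ge (|μ| / (ε / 4))
    refine ⟨N + 1, by omega, ?_⟩
    rw [div_le_iff₀ (by positivity)] at hN ⊢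
    push_cast
    linarith
  have hN0 : (0 : ℝ) < N := by exact_mod_cast hN1
  set V : ℝ := 4 + 2 * ((K + 1) ^ 2 * fluct (2 * K) * N) with hV
  have hV0 : 0 < V := by positivity
  refine ⟨(ε / 4) ^ 2 / (2 * V), by positivity, ?_⟩
  filter_upwards [eventually_ge_atTop 3,
    tendsto_natCast_atTop_atTop.eventually_ge_atTop (2 * K * |μ| / (ε / 4))] with n hn3 hnK
  have hn0 : (0 : ℝ) < n := by exact_mod_cast (by omega : 0 < n)
  have hlog : 1 ≤ Real.log n := by
    rw [Real.le_log_iff_exp_le hn0]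
    have h3 : (3 : ℝ) ≤ n := by exact_mod_cast hn3
    linarith [Real.exp_one_lt_d9]
  -- The flow lasts `m` steps, about `n / N`; the tubes consist of `q` blocks.
  obtain ⟨r, hr⟩ : ∃ r, r = n / N := ⟨_, rfl⟩
  obtain ⟨q, hq⟩ : ∃ q, q = (n - r) / (2 * K) := ⟨_, rfl⟩
  obtain ⟨m, hm⟩ : ∃ m, m = n - 2 * K * q := ⟨_, rfl⟩
  have hNn : r ≤ n := hr ▸ Nat.div_le_self _ _
  have h2K : 2 * K * q ≤ n - r := by
    rw [hq]; exact Nat.mul_div_le _ _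
  have h2K' : n - r < 2 * K * q + 2 * K := by
    rw [hq]; exact Nat.lt_mul_div_succ _ (by omega)
  have hmn : m + 2 * K * q = n := by omega
  have hmN : r ≤ m := by omega
  have hmN' : m ≤ r + 2 * K := by omega
  have hqn : q ≤ n := by
    have : q ≤ 2 * K * q := Nat.le_mul_of_pos_left q (by omega)
    omega
  have hm1 : (n : ℝ) / N ≤ m + 1 := by
    rw [div_le_iff₀ hN0]
    have : n < (m + 1) * N := by
      have := Nat.lt_mul_div_succ n (show 0 < N by omega)
      rw [← hr] at this
      calc n < N * (r + 1) := this
        _ ≤ (m + 1) * N := by rw [mul_comm]; gcongr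
    exact_mod_cast this.le
  have hm2 : (m : ℝ) ≤ n / N + 2 * K := by
    have h1 : (r : ℝ) ≤ n / N := hr ▸ Nat.cast_div_le
    have h2 : (m : ℝ) ≤ r + 2 * K := by exact_mod_cast hmN'
    linarith
  have hqm : (q : ℝ) / (m + 1) ≤ N := by
    rw [div_le_iff₀ (by positivity)]
    have h1 : (q : ℝ) ≤ n := by exact_mod_cast hqn
    rw [div_le_iff₀ hN0] at hm1
    linarith
  have hharm : (harmonic m : ℝ) ≤ 2 * Real.log n := by
    have h1 := harmonic_le_one_add_log m
    have h2 : Real.log m ≤ Real.log n := by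
      rcases Nat.eq_zero_or_pos m with h0 | h0
      · rw [h0]; simp; linarith
      · exact Real.log_le_log (by exact_mod_cast h0) (by exact_mod_cast (by omega : m ≤ n))
    linarith
  have hc : 2 * (harmonic m : ℝ) + 2 * ((K + 1) ^ 2 * fluct (2 * K) * (q / (m + 1)))
      ≤ (⟨V * Real.log n, by positivity⟩ : NNReal) := by
    change _ ≤ V * Real.log n
    have h1 : ((K : ℝ) + 1) ^ 2 * fluct (2 * K) * (q / (m + 1))
        ≤ (K + 1) ^ 2 * fluct (2 * K) * N := by gcongr
    have h2 : 2 * (((K : ℝ) + 1) ^ 2 * fluct (2 * K) * N) * 1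
        ≤ 2 * ((K + 1) ^ 2 * fluct (2 * K) * N) * Real.log n := by gcongr
    rw [hV]
    linarith
  have htail := (hasSubgaussianMGF_urnFlow_add_block K m q hc).neg.measure_ge_le
    (show 0 ≤ ε / 4 * n by positivity)
  refine (measureReal_mono fun w hw => ?_).trans (htail.trans (le_of_eq ?_))
  · have hle := urnFlow_add_block_le K m q w
    rw [hmn] at hle
    simp only [Set.mem_ofPred_eq, Pi.neg_apply] at hw ⊢
    have hsum : ((m : ℝ) + 1)⁻¹ * ∑ i ∈ Finset.range (m + 1), ∑ k ∈ Finset.range q,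
          (block K m i k w - meanStraight K)
        = (∑ i ∈ Finset.range (m + 1), ∑ k ∈ Finset.range q, block K m i k w) / (m + 1)
          - q * meanStraight K := by
      simp only [Finset.sum_sub_distrib, Finset.sum_const, Finset.card_range, nsmul_eq_mul]
      push_cast
      field_simp
    rw [hsum]
    have hq1 : (2 * K * q : ℝ) * (μ - ε / 4) ≤ q * meanStraight K := by
      have := mul_le_mul_of_nonneg_left hK (Nat.cast_nonneg (α := ℝ) q)
      linarith
    have hnm : (2 * K * q : ℝ) = n - m := by
      have : (m : ℝ) + 2 * K * q = n := by exact_mod_cast hmn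
      linarith
    rw [hnm] at hq1
    have hm0 : (0 : ℝ) ≤ m := Nat.cast_nonneg m
    have hmμ : m * μ ≤ ε / 2 * n := by
      have h1 : (m : ℝ) * μ ≤ m * |μ| := by gcongr; exact le_abs_self μ
      have h2 : (m : ℝ) * |μ| ≤ (n / N + 2 * K) * |μ| := by gcongr
      have h3 : (n : ℝ) / N * |μ| ≤ ε / 4 * n := by
        have := mul_le_mul_of_nonneg_left hN hn0.le
        calc (n : ℝ) / N * |μ| = n * (|μ| / N) := by ring
          _ ≤ n * (ε / 4) := this
          _ = ε / 4 * n := by ring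
      rw [div_le_iff₀ (by positivity)] at hnK
      linarith
    have hmε : 0 ≤ m * ε := by positivity
    linarith
  · congr 1
    change -(ε / 4 * n) ^ 2 / (2 * (V * Real.log n)) = _
    field_simp

/-! ### The lower bound on the lower tail -/

section Decomposition

variable {κ : Type*}

theorem memLp_coord (e : κ) : MemLp (fun w : κ → ℝ => w e) 2 (gaussianField κ) :=
  (memLp_id_gaussianReal (μ := 0) (v := 1) 2).comp_measurePreserving (measurePreserving_coord e)

theorem memLp_linear (S : Finset κ) (θ : κ → ℝ) :
    MemLp (fun w : κ → ℝ => ∑ e ∈ S, θ e * w e) 2 (gaussianField κ) :=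
  memLp_finsetSum _ fun e _ => (memLp_coord e).const_mul _

theorem covariance_coord_linear {S : Finset κ} (θ : κ → ℝ) {e : κ} (he : e ∈ S) :
    cov[fun w : κ → ℝ => w e, fun w => ∑ e' ∈ S, θ e' * w e'; gaussianField κ] = θ e := by
  rw [covariance_fun_sum_right' (fun e' _ => (memLp_coord e').const_mul _) (memLp_coord e)]
  simp_rw [covariance_const_mul_right]
  rw [Finset.sum_eq_single e]
  · rw [covariance_self (measurable_pi_apply e).aemeasurable]
    have h := variance_map (X := (id : ℝ → ℝ)) (μ := gaussianField κ)
      (Y := fun w : κ → ℝ => w e) (by fun_prop) (measurable_pi_apply e).aemeasurable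
    rw [(measurePreserving_coord e).map_eq, variance_id_gaussianReal] at h
    have h' : Var[fun w : κ → ℝ => w e; gaussianField κ] = 1 := by
      simpa [Function.comp_def] using h.symm
    rw [h', mul_one]
  · intro e' _ hne
    rw [((iIndepFun_coord κ).indepFun hne.symm).covariance_eq_zero (memLp_coord e) (memLp_coord e'),
      mul_zero]
  · exact fun h => absurd he h

theorem covariance_linear_self (S : Finset κ) (θ : κ → ℝ) :
    cov[fun w : κ → ℝ => ∑ e ∈ S, θ e * w e, fun w => ∑ e ∈ S, θ e * w e; gaussianField κ]
      = ∑ e ∈ S, θ e ^ 2 := by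
  rw [covariance_fun_sum_left' (fun e' _ => (memLp_coord e').const_mul _) (memLp_linear S θ)]
  refine Finset.sum_congr rfl fun e he => ?_
  rw [covariance_const_mul_left, covariance_coord_linear θ he, sq]

theorem hasGaussianLaw_restrict (S : Finset κ) :
    HasGaussianLaw (fun (w : κ → ℝ) (e : S) => w e) (gaussianField κ) := by
  refine iIndepFun.hasGaussianLaw (X := fun (e : S) (w : κ → ℝ) => w e) (fun e => ?_)
    ((iIndepFun_coord κ).precomp Subtype.val_injective)
  exact (measurePreserving_coord (e : κ)).hasLaw.hasGaussianLaw

/-- The linear map that sends a vector `x` indexed by `S` to `x - (⟨θ, x⟩ / s) θ`, its component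
orthogonal to `θ` when `s` is the squared norm of `θ`, together with `⟨θ, x⟩`. -/
noncomputable def splitAlong (S : Finset κ) (θ : κ → ℝ) (s : ℝ) :
    (S → ℝ) →L[ℝ] (S → ℝ) × (Unit → ℝ) :=
  LinearMap.toContinuousLinearMap
    { toFun := fun x =>
        (fun e => x e - θ e / s * ∑ e' : S, θ e' * x e', fun _ => ∑ e' : S, θ e' * x e')
      map_add' := fun x y => by
        ext
        · simp only [Pi.add_apply, mul_add, Finset.sum_add_distrib, Prod.fst_add]; ring
        · simp only [Pi.add_apply, mul_add, Finset.sum_add_distrib, Prod.snd_add]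
      map_smul' := fun r x => by
        have h : ∑ e' : S, θ e' * (r * x e') = r * ∑ e' : S, θ e' * x e' := by
          rw [Finset.mul_sum]
          exact Finset.sum_congr rfl fun e _ => by ring
        ext
        · simp only [Pi.smul_apply, smul_eq_mul, h, RingHom.id_apply, Prod.smul_fst]; ring
        · simp only [Pi.smul_apply, smul_eq_mul, h, RingHom.id_apply, Prod.smul_snd] }

/-- A Gaussian vector minus its projection to a direction is independent of the projection. -/
theorem indepFun_linear {S : Finset κ} {θ : κ → ℝ} {s : ℝ} (hs : ∑ e ∈ S, θ e ^ 2 = s)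
    (hs0 : s ≠ 0) :
    IndepFun (fun (w : κ → ℝ) (e : S) => w e - θ e / s * ∑ e' ∈ S, θ e' * w e')
      (fun (w : κ → ℝ) (_ : Unit) => ∑ e' ∈ S, θ e' * w e') (gaussianField κ) := by
  have hG := (hasGaussianLaw_restrict S).map_fun (splitAlong S θ s)
  have hsum : ∀ w : κ → ℝ, ∑ e' : S, θ e' * w e' = ∑ e' ∈ S, θ e' * w e' := fun w =>
    Finset.sum_coe_sort S fun e => θ e * w e
  have hG' : HasGaussianLaw (fun w : κ → ℝ =>
      (fun e : S => w e - θ e / s * ∑ e' ∈ S, θ e' * w e', fun _ : Unit => ∑ e' ∈ S, θ e' * w e'))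
      (gaussianField κ) :=
    hG.congr (ae_of_all _ fun w => by
      change (fun e : S => w e - θ e / s * ∑ e' : S, θ e' * w e',
        fun _ : Unit => ∑ e' : S, θ e' * w e') = _
      rw [hsum])
  refine HasGaussianLaw.indepFun_of_covariance_eval
    (X := fun (e : S) (w : κ → ℝ) => w e - θ e / s * ∑ e' ∈ S, θ e' * w e')
    (Y := fun (_ : Unit) (w : κ → ℝ) => ∑ e' ∈ S, θ e' * w e') hG' fun e _ => ?_
  rw [covariance_fun_sub_left (memLp_coord _) ((memLp_linear S θ).const_mul _)
    (memLp_linear S θ), covariance_const_mul_left, covariance_coord_linear θ e.2,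
    covariance_linear_self, hs]
  field_simp
  ring

theorem map_linear_eq_gaussianReal (S : Finset κ) (θ : κ → ℝ) :
    (gaussianField κ).map (fun w => ∑ e ∈ S, θ e * w e)
      = gaussianReal 0 (∑ e ∈ S, θ e ^ 2).toNNReal := by
  have hG : HasGaussianLaw (fun w : κ → ℝ => ∑ e ∈ S, θ e * w e) (gaussianField κ) := by
    have h := (((hasGaussianLaw_restrict S).map_fun (splitAlong S θ 1)).snd).eval ()
    have hsum : ∀ w : κ → ℝ, ∑ e' : S, θ e' * w e' = ∑ e' ∈ S, θ e' * w e' := fun w =>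
      Finset.sum_coe_sort S fun e => θ e * w e
    exact h.congr (ae_of_all _ fun w => hsum w)
  rw [hG.map_eq_gaussianReal, ← covariance_self hG.aemeasurable, covariance_linear_self]
  congr 1
  rw [integral_finsetSum _ fun e _ => (integrable_coord e).const_mul _]
  simp_rw [integral_const_mul, integral_coord]
  simp

end Decomposition

/-- The density is bounded below on the interval of length `√v` to the left of `-x`. -/
theorem le_gaussianReal_Iic {v : NNReal} (hv : v ≠ 0) {x : ℝ} (hx : 0 ≤ x) :
    Real.exp (-(x ^ 2 / v) - 1) / √(2 * Real.pi) ≤ (gaussianReal 0 v).real (Set.Iic (-x)) := by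
  have hv0 : (0 : ℝ) < v := by positivity
  set r := √(v : ℝ) with hr
  have hr0 : 0 < r := Real.sqrt_pos.2 hv0
  have hr2 : r ^ 2 = v := Real.sq_sqrt hv0.le
  have hsub : Set.Icc (-x - r) (-x) ⊆ Set.Iic (-x) := fun y hy => hy.2
  rw [measureReal_def, gaussianReal_apply_eq_integral 0 hv,
    ENNReal.toReal_ofReal (integral_nonneg fun y => gaussianPDFReal_nonneg _ _ _)]
  have hi := (integrable_gaussianPDFReal 0 v).integrableOn (s := Set.Iic (-x))
  have hle : ∀ y ∈ Set.Icc (-x - r) (-x),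
      Real.exp (-(x ^ 2 / v) - 1) / (r * √(2 * Real.pi)) ≤ gaussianPDFReal 0 v y := fun y hy => by
    rw [gaussianPDFReal_def]
    simp only [sub_zero]
    rw [Real.sqrt_mul' _ hv0.le, ← hr, inv_mul_eq_div, mul_comm r]
    gcongr
    have h1 : y ^ 2 ≤ 2 * x ^ 2 + 2 * v := by
      rw [← hr2]
      nlinarith [hy.1, hy.2, sq_nonneg (x - r)]
    have h2 : -(x ^ 2 / v) - 1 = -(2 * x ^ 2 + 2 * v) / (2 * v) := by field_simp; ring
    rw [h2]
    gcongr
  calc Real.exp (-(x ^ 2 / v) - 1) / √(2 * Real.pi)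
      = ∫ _ in Set.Icc (-x - r) (-x), Real.exp (-(x ^ 2 / v) - 1) / (r * √(2 * Real.pi)) := by
        rw [setIntegral_const, Real.volume_real_Icc_of_le (by linarith), smul_eq_mul]
        field_simp
        ring
    _ ≤ ∫ y in Set.Icc (-x - r) (-x), gaussianPDFReal 0 v y :=
        setIntegral_mono_on (by simp) (hi.mono_set hsub) measurableSet_Icc hle
    _ ≤ ∫ y in Set.Iic (-x), gaussianPDFReal 0 v y :=
        setIntegral_mono_set hi (ae_of_all _ fun y => gaussianPDFReal_nonneg _ _ _)
          (ae_of_all _ hsub)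

/-- The direction in which the weights are depressed to realize the lower tail. -/
noncomputable def tilt (e : Bond) : ℝ := 1 / ((e.1 : ℝ) + 1)

theorem sum_tilt_sq (n : ℕ) : ∑ e ∈ cone n, tilt e ^ 2 = 2 * harmonic n := by
  rw [sum_cone, harmonic]
  push_cast
  rw [Finset.mul_sum]
  refine Finset.sum_congr rfl fun t _ => ?_
  simp only [tilt, Finset.sum_const, Finset.card_range, nsmul_eq_mul]
  push_cast
  field_simp
  norm_num

/-- The tilt is constant at each time, so all paths gain the same. -/
theorem val_tilt (l : List Bool) : val tilt 0 0 l = harmonic l.length := by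
  induction l using List.reverseRecOn with
  | nil => simp [val_nil]
  | append_singleton l b ih =>
    rw [val_append, ih, List.length_append, List.length_singleton, harmonic_succ, val_cons, val_nil]
    simp [tilt]

theorem maxVal_add_mul_tilt (n : ℕ) (w : Bond → ℝ) (r : ℝ) :
    maxVal (words n) (fun e => w e + r * tilt e) 0 0
      = maxVal (words n) w 0 0 + r * harmonic n := by
  have hval : ∀ l ∈ words n, val (fun e => w e + r * tilt e) 0 0 l = val w 0 0 l + r * harmonic n :=
    fun l hl => by rw [val_add_mul, val_tilt, mem_words.1 hl]
  refine le_antisymm (maxVal_le (words_nonempty n) fun l hl => ?_) ?_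
  · rw [hval l hl]
    linarith [le_maxVal hl w 0 0]
  · obtain ⟨l, hl, h⟩ := exists_maxVal_eq (words_nonempty n) w 0 0
    rw [h, ← hval l hl]
    exact le_maxVal hl _ 0 0

/-- Extension by zero of weights on the cone. -/
noncomputable def extendCone (n : ℕ) (x : cone n → ℝ) (e : Bond) : ℝ :=
  if h : e ∈ cone n then x ⟨e, h⟩ else 0

theorem measurable_extendCone (n : ℕ) : Measurable (extendCone n) := by
  refine measurable_pi_iff.2 fun e => ?_
  by_cases h : e ∈ cone n
  · simp only [extendCone, h, dite_true]; fun_prop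
  · simp only [extendCone, h, dite_false]; fun_prop

theorem maxVal_extendCone (n : ℕ) (w : Bond → ℝ) :
    maxVal (words n) (extendCone n fun e => w e) 0 0 = maxVal (words n) w 0 0 := by
  refine maxVal_congr fun l hl => val_congr l fun t i b _ h2 h3 _ h5 => ?_
  rw [mem_words.1 hl] at h2
  have h : (t, i, b) ∈ cone n := mem_cone.2 ⟨by omega, h3, by push_cast at h5; simp only; omega⟩
  simp [extendCone, h]

/-- The maximum, corrected by its dependence on the total tilt of the weights, is independent of
the tilt. -/
theorem indepFun_maxVal_sub_tilt {n : ℕ} (hn : n ≠ 0) :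
    IndepFun (fun w => maxVal (words n) w 0 0 - (∑ e ∈ cone n, tilt e * w e) / 2)
      (fun w => ∑ e ∈ cone n, tilt e * w e) (gaussianField Bond) := by
  have hH : (0 : ℝ) < harmonic n := by exact_mod_cast harmonic_pos hn
  have h := indepFun_linear (sum_tilt_sq n) (by positivity)
  have hψ : Measurable fun x : Unit → ℝ => x () := measurable_pi_apply ()
  have h' := h.comp (φ := fun x => maxVal (words n) (extendCone n x) 0 0)
    (ψ := fun x : Unit → ℝ => x ()) ((measurable_maxVal 0 0).comp (measurable_extendCone n))
    hψ
  refine IndepFun.congr h' (ae_of_all _ fun w => ?_) (ae_of_all _ fun w => rfl)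
  simp only [Function.comp]
  have h2 := maxVal_extendCone n fun e =>
    w e - tilt e / (2 * harmonic n) * ∑ e' ∈ cone n, tilt e' * w e'
  rw [h2]
  have h3 := maxVal_add_mul_tilt n w (-(∑ e' ∈ cone n, tilt e' * w e') / (2 * harmonic n))
  have h4 : (fun e => w e + -(∑ e' ∈ cone n, tilt e' * w e') / (2 * harmonic n) * tilt e)
      = fun e => w e - tilt e / (2 * harmonic n) * ∑ e' ∈ cone n, tilt e' * w e' := by
    funext e; ring
  rw [h4] at h3
  rw [h3]
  field_simp
  ring

/-- The variable that is independent of the tilt exceeds the time constant with small probability: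
by the law of large numbers, and because the tilt is of order `√(log n)`. -/
theorem eventually_half_le {ε : ℝ} (hε : 0 < ε) : ∀ᶠ n : ℕ in atTop,
    1 / 2 ≤ (gaussianField Bond).real {w | maxVal (words n) w 0 0
      - (∑ e ∈ cone n, tilt e * w e) / 2 ≤ (timeConst + ε) * n} := by
  set P := gaussianField Bond
  have hm : ∀ n, Measurable fun w : Bond → ℝ => maxVal (words n) w 0 0 := fun n =>
    measurable_maxVal 0 0
  have h1 : Tendsto (fun n : ℕ => P.real {w | ε / 2 ≤
      dist (maxVal (words n) w 0 0 / (n : ℝ)) timeConst}) atTop (𝓝 0) := by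
    have h := tendstoInMeasure_of_tendsto_ae (μ := P)
      (f := fun (n : ℕ) w => maxVal (words n) w 0 0 / (n : ℝ)) (g := fun _ => timeConst)
      (fun n => ((hm n).div_const _).aestronglyMeasurable) ae_tendsto_maxVal_words_div
    rw [tendstoInMeasure_iff_measureReal_dist] at h
    exact h (ε / 2) (half_pos hε)
  have h2 : Tendsto (fun n : ℕ => Real.exp (-(ε ^ 2 / 8 * n))) atTop (𝓝 0) :=
    Real.tendsto_exp_neg_atTop_nhds_zero.comp
      (tendsto_natCast_atTop_atTop.const_mul_atTop (by positivity))
  filter_upwards [h1.eventually (gt_mem_nhds (show (0 : ℝ) < 1 / 4 by norm_num)),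
    h2.eventually (gt_mem_nhds (show (0 : ℝ) < 1 / 4 by norm_num)), eventually_ge_atTop 1]
    with n hn1 hn2 hn
  have hn0 : (0 : ℝ) < n := by exact_mod_cast hn
  have hH : (0 : ℝ) < harmonic n := by exact_mod_cast harmonic_pos (by omega)
  have hHn : (harmonic n : ℝ) ≤ 2 * n := by
    have := harmonic_le_one_add_log n
    have h3 := Real.log_le_sub_one_of_pos hn0
    linarith
  set G : (Bond → ℝ) → ℝ := fun w => ∑ e ∈ cone n, tilt e * w e with hG
  have hsub := hasSubgaussianMGF_linear (cone n) tilt (c := ⟨2 * harmonic n, by positivity⟩)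
    (sum_tilt_sq n).le
  have h3 : P.real {w | ε * n ≤ -G w} ≤ 1 / 4 := by
    refine (hsub.neg.measure_ge_le (show 0 ≤ ε * n by positivity)).trans (le_trans ?_ hn2.le)
    refine Real.exp_le_exp.2 ?_
    change -(ε * n) ^ 2 / (2 * (2 * (harmonic n : ℝ))) ≤ _
    rw [neg_div, neg_le_neg_iff, le_div_iff₀ (by positivity)]
    nlinarith [mul_le_mul_of_nonneg_left hHn (show 0 ≤ ε ^ 2 * n by positivity)]
  have hGm : Measurable G := Finset.measurable_sum _ fun e _ => (measurable_pi_apply e).const_mul _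
  have hsm : MeasurableSet {w | maxVal (words n) w 0 0 - G w / 2 ≤ (timeConst + ε) * n} :=
    measurableSet_le ((hm n).sub (hGm.div_const _)) measurable_const
  have h4 : {w | maxVal (words n) w 0 0 - G w / 2 ≤ (timeConst + ε) * n}ᶜ
      ⊆ {w | ε / 2 ≤ dist (maxVal (words n) w 0 0 / (n : ℝ)) timeConst} ∪ {w | ε * n ≤ -G w} := by
    intro w hw
    simp only [Set.mem_compl_iff, Set.mem_ofPred_eq, not_le, Set.mem_union] at hw ⊢
    by_contra! hcon
    obtain ⟨hc1, hc2⟩ := hcon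
    rw [Real.dist_eq, abs_lt] at hc1
    have h5 : maxVal (words n) w 0 0 / (n : ℝ) < timeConst + ε / 2 := by linarith
    rw [div_lt_iff₀ hn0] at h5
    linarith
  have h5 := (measureReal_mono (μ := P) h4).trans (measureReal_union_le _ _)
  rw [probReal_compl_eq_one_sub hsm] at h5
  linarith

/-- The lower tail at distance `ε * n` has probability at least `exp (-C * n ^ 2 / log n)`, the
price of depressing the weights in the direction `tilt`. -/
theorem exists_exp_le_measureReal {ε : ℝ} (hε : 0 < ε) : ∃ C : ℝ, ∀ᶠ n : ℕ in atTop,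
    Real.exp (-(C * ((n : ℝ) ^ 2 / Real.log n)))
      ≤ (gaussianField Bond).real {w | maxVal (words n) w 0 0 ≤ (timeConst - ε) * n} := by
  set P := gaussianField Bond
  refine ⟨8 * ε ^ 2 + 3, ?_⟩
  filter_upwards [eventually_half_le hε, eventually_ge_atTop 2] with n hn hn2
  have hn0 : (0 : ℝ) < n := by exact_mod_cast (by omega : 0 < n)
  have hn1 : (1 : ℝ) < n := by exact_mod_cast (by omega : 1 < n)
  have hlog : 0 < Real.log n := Real.log_pos hn1
  have hlogn : Real.log n ≤ n ^ 2 := by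
    have := Real.log_le_sub_one_of_pos hn0
    nlinarith
  have hH : Real.log n ≤ harmonic n := by
    refine le_trans (Real.log_le_log hn0 ?_) (log_add_one_le_harmonic n)
    push_cast; linarith
  set G : (Bond → ℝ) → ℝ := fun w => ∑ e ∈ cone n, tilt e * w e with hG
  have hGm : Measurable G := Finset.measurable_sum _ fun e _ => (measurable_pi_apply e).const_mul _
  set v : NNReal := (∑ e ∈ cone n, tilt e ^ 2).toNNReal with hv
  have hvH : (v : ℝ) = 2 * harmonic n := by
    rw [hv, sum_tilt_sq, Real.coe_toNNReal _ (by linarith)]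
  have hv0 : v ≠ 0 := fun h => by
    rw [h] at hvH
    simp only [NNReal.coe_zero] at hvH
    linarith
  have hGlaw : P.real {w | G w ≤ -(4 * ε * n)}
      = (gaussianReal 0 v).real (Set.Iic (-(4 * ε * n))) := by
    rw [← map_linear_eq_gaussianReal, map_measureReal_apply hGm measurableSet_Iic]
    rfl
  -- The tilt enters the maximum with the factor `1 / 2`, and has to bring it from `timeConst + ε`
  -- to `timeConst - ε`.
  have htail := le_gaussianReal_Iic hv0 (show 0 ≤ 4 * ε * n by positivity)
  rw [← hGlaw, hvH] at htail
  have hind := (indepFun_maxVal_sub_tilt (n := n) (by omega)).measure_inter_preimage_eq_mul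
    (Set.Iic ((timeConst + ε) * n)) (Set.Iic (-(4 * ε * n))) measurableSet_Iic measurableSet_Iic
  have hsub : {w | maxVal (words n) w 0 0 - G w / 2 ≤ (timeConst + ε) * n}
      ∩ {w | G w ≤ -(4 * ε * n)} ⊆ {w | maxVal (words n) w 0 0 ≤ (timeConst - ε) * n} := by
    rintro w ⟨h1, h2⟩
    simp only [Set.mem_ofPred_eq] at h1 h2 ⊢
    linarith
  have hprod : P.real ({w | maxVal (words n) w 0 0 - G w / 2 ≤ (timeConst + ε) * n}
      ∩ {w | G w ≤ -(4 * ε * n)})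
      = P.real {w | maxVal (words n) w 0 0 - G w / 2 ≤ (timeConst + ε) * n}
        * P.real {w | G w ≤ -(4 * ε * n)} := by
    have := congrArg ENNReal.toReal hind
    rw [ENNReal.toReal_mul] at this
    exact this
  refine le_trans ?_ (measureReal_mono hsub)
  rw [hprod]
  -- `√(2 * π) ≤ 3`, and `6 ≤ exp 2`.
  have hpi : √(2 * Real.pi) ≤ 3 := by
    rw [Real.sqrt_le_left (by norm_num)]
    linarith [Real.pi_lt_four]
  have he2 : 6 ≤ Real.exp 2 := by
    have h1 := Real.exp_one_gt_d9
    have h2 : Real.exp 2 = Real.exp 1 * Real.exp 1 := by rw [← Real.exp_add]; norm_num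
    rw [h2]
    nlinarith
  have hexp : (4 * ε * n) ^ 2 / (2 * (harmonic n : ℝ)) ≤ 8 * ε ^ 2 * (n ^ 2 / Real.log n) := by
    calc (4 * ε * n) ^ 2 / (2 * (harmonic n : ℝ)) ≤ (4 * ε * n) ^ 2 / (2 * Real.log n) := by
          gcongr
      _ = 8 * ε ^ 2 * (n ^ 2 / Real.log n) := by field_simp; ring
  have hone : 1 ≤ (n : ℝ) ^ 2 / Real.log n := by rwa [one_le_div hlog]
  have hsqrt : 0 < √(2 * Real.pi) := Real.sqrt_pos.2 (by positivity)
  calc Real.exp (-((8 * ε ^ 2 + 3) * ((n : ℝ) ^ 2 / Real.log n)))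
      ≤ Real.exp (-((4 * ε * n) ^ 2 / (2 * (harmonic n : ℝ))) - 1 - 2) := by
        refine Real.exp_le_exp.2 ?_
        linarith
    _ = Real.exp (-((4 * ε * n) ^ 2 / (2 * (harmonic n : ℝ))) - 1) / Real.exp 2 := Real.exp_sub _ _
    _ ≤ Real.exp (-((4 * ε * n) ^ 2 / (2 * (harmonic n : ℝ))) - 1) / (2 * √(2 * Real.pi)) := by
        gcongr
        linarith
    _ = 1 / 2 * (Real.exp (-((4 * ε * n) ^ 2 / (2 * (harmonic n : ℝ))) - 1) / √(2 * Real.pi)) := by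
        field_simp
    _ ≤ _ := by
        refine mul_le_mul hn htail (by positivity) measureReal_nonneg

/-! ### Transfer to the original lattice -/

theorem Site.ext {u v : Site} (h : u.pos = v.pos) (h' : u.time = v.time) : u = v :=
  Subtype.ext (Prod.ext h h')

/-- The site reached at time `t` after `i` up-steps and `t - i` down-steps. -/
def siteAt (t : ℕ) (i : ℤ) : Site :=
  ⟨(2 * i - t, t), by
    rw [Int.even_add, even_abs, Int.even_sub]; simp⟩

theorem siteAt_pos (t : ℕ) (i : ℤ) : (siteAt t i).pos = 2 * i - t := rfl

theorem siteAt_time (t : ℕ) (i : ℤ) : (siteAt t i).time = t := rfl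

theorem isEdge_siteAt (t : ℕ) (i : ℤ) (b : Bool) :
    IsEdge (siteAt t i) (siteAt (t + 1) (i + b.toNat)) := by
  simp only [IsEdge, siteAt_pos, siteAt_time]
  cases b
  all_goals simp
  all_goals omega

/-- The edge of the original lattice with the given coordinates. -/
def toEdge (e : Bond) : Edge :=
  ⟨(siteAt e.1 e.2.1, siteAt (e.1 + 1) (e.2.1 + e.2.2.toNat)), isEdge_siteAt _ _ _⟩

theorem toEdge_injective : Function.Injective toEdge := by
  rintro ⟨t, i, b⟩ ⟨t', i', b'⟩ h
  have h1 : siteAt t i = siteAt t' i' := congrArg (fun e : Edge => e.1.1) h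
  have h2 : siteAt (t + 1) (i + b.toNat) = siteAt (t' + 1) (i' + b'.toNat) :=
    congrArg (fun e : Edge => e.1.2) h
  have ht : t = t' := congrArg Site.time h1
  have hi := congrArg Site.pos h1
  have hb := congrArg Site.pos h2
  simp only [siteAt_pos] at hi hb
  subst ht
  obtain rfl : i = i' := by omega
  have : b = b' := by cases b <;> cases b' <;> simp at hb ⊢
  rw [this]

/-- Every edge out of a site is one of the two edges with these coordinates. -/
theorem exists_eq_siteAt {t : ℕ} {i : ℤ} {v : Site} (h : IsEdge (siteAt t i) v) :
    ∃ b : Bool, v = siteAt (t + 1) (i + b.toNat) := by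
  obtain ⟨h1 | h1, h2⟩ := h
  · refine ⟨true, Site.ext ?_ h2⟩
    rw [h1, siteAt_pos, siteAt_pos]; push_cast; simp; ring
  · refine ⟨false, Site.ext ?_ h2⟩
    rw [h1, siteAt_pos, siteAt_pos]; push_cast; simp; ring

theorem exists_word_of_path {n : ℕ} (γ : Path n) : ∃ l : List Bool, l.length = n ∧
    γ.site (Fin.last n) = siteAt n (l.count true) ∧
    ∀ w : Edge → ℝ, γ.value w = val (fun e => w (toEdge e)) 0 0 l := by
  induction n with
  | zero => exact ⟨[], rfl, γ.start, fun w => by simp [Path.value, val_nil]⟩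
  | succ n ih =>
    obtain ⟨l, hl, hlast, hval⟩ :=
      ih ⟨fun i => γ.site i.castSucc, γ.start, fun i => γ.step i.castSucc⟩
    have hlast' : γ.site (Fin.last n).castSucc = siteAt n (l.count true) := hlast
    have hstep := γ.step (Fin.last n)
    rw [hlast'] at hstep
    obtain ⟨b, hb⟩ := exists_eq_siteAt hstep
    refine ⟨l ++ [b], by simp [hl], ?_, fun w => ?_⟩
    · rw [List.count_append, count_true_cons]
      simpa using hb
    · have hedge : γ.edge (Fin.last n) = toEdge (n, l.count true, b) :=
        Subtype.ext (Prod.ext hlast' hb)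
      rw [val_append, ← hval, val_cons, val_nil, Path.value, Fin.sum_univ_castSucc, hedge, hl]
      simp [Path.value, Path.edge]

theorem exists_path_of_word (l : List Bool) : ∃ γ : Path l.length,
    γ.site (Fin.last _) = siteAt l.length (l.count true) ∧
    ∀ w : Edge → ℝ, γ.value w = val (fun e => w (toEdge e)) 0 0 l := by
  induction l using List.reverseRecOn with
  | nil =>
    exact ⟨⟨fun _ => origin, rfl, fun i => i.elim0⟩, rfl, fun w => by simp [Path.value, val_nil]⟩
  | append_singleton l b ih =>
    obtain ⟨γ, hlast, hval⟩ := ih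
    have hlen : (l ++ [b]).length = l.length + 1 := by simp
    have hcount : (l ++ [b]).count true = l.count true + b.toNat := by
      rw [List.count_append, count_true_cons]; simp
    rw [hlen, hcount]
    have hstep : ∀ i : Fin (l.length + 1), IsEdge
        (Fin.snoc (α := fun _ => Site) γ.site
          (siteAt (l.length + 1) ((l.count true : ℤ) + b.toNat)) i.castSucc)
        (Fin.snoc (α := fun _ => Site) γ.site
          (siteAt (l.length + 1) ((l.count true : ℤ) + b.toNat)) i.succ) := by
      intro i
      induction i using Fin.lastCases with
      | last =>
        rw [Fin.snoc_castSucc, Fin.succ_last, Fin.snoc_last, hlast]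
        exact isEdge_siteAt _ _ _
      | cast i =>
        rw [Fin.snoc_castSucc, Fin.succ_castSucc, Fin.snoc_castSucc]
        exact γ.step i
    refine ⟨⟨Fin.snoc (α := fun _ => Site) γ.site
      (siteAt (l.length + 1) ((l.count true : ℤ) + b.toNat)), ?_, hstep⟩, ?_, fun w => ?_⟩
    · rw [← Fin.castSucc_zero, Fin.snoc_castSucc]
      exact γ.start
    · simp
    · rw [val_append, ← hval, val_cons, val_nil, Path.value, Fin.sum_univ_castSucc, Path.value,
        add_zero]
      congr 1
      · refine Finset.sum_congr rfl fun i _ => congrArg w (Subtype.ext (Prod.ext ?_ ?_))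
        · simp [Path.edge]
        · simp only [Path.edge, Fin.succ_castSucc, Fin.snoc_castSucc]
      · refine congrArg w (Subtype.ext (Prod.ext ?_ ?_))
        · simp [Path.edge, hlast, toEdge]
        · simp [Path.edge, toEdge]

theorem lastPassage_eq_maxVal (w : Edge → ℝ) (n : ℕ) :
    lastPassage w n = maxVal (words n) (fun e => w (toEdge e)) 0 0 := by
  refine le_antisymm (ciSup_le fun γ => ?_) (maxVal_le (words_nonempty n) fun l hl => ?_)
  · obtain ⟨l, hl, -, h⟩ := exists_word_of_path γ
    rw [h]
    exact le_maxVal (mem_words.2 hl) _ 0 0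
  · obtain rfl := mem_words.1 hl
    obtain ⟨γ, -, h⟩ := exists_path_of_word l
    rw [← h]
    exact le_ciSup (f := fun γ : Path l.length => γ.value w) (Set.finite_range _).bddAbove γ

theorem hasLaw_gaussianField {Ω : Type*} [MeasurableSpace Ω] {P : Measure Ω}
    [IsProbabilityMeasure P] {X : Edge → Ω → ℝ} (hindep : iIndepFun X P)
    (hlaw : ∀ e, HasLaw (X e) (gaussianReal 0 1) P) :
    HasLaw (fun ω (e : Bond) => X (toEdge e) ω) (gaussianField Bond) P :=
  (hindep.precomp toEdge_injective).hasLaw_infinitePi (fun e => hlaw (toEdge e))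
    (aemeasurable_pi_iff.2 fun e => (hlaw (toEdge e)).aemeasurable)

theorem coe_mul_log_le {x y : ℝ} {p : ENNReal} (hx : 0 ≤ x) (h : p ≤ ENNReal.ofReal (Real.exp y)) :
    (x : EReal) * ENNReal.log p ≤ ((x * y : ℝ) : EReal) := by
  rw [EReal.coe_mul]
  refine mul_le_mul_of_nonneg_left ?_ (by exact_mod_cast hx)
  refine (ENNReal.log_monotone h).trans ?_
  rw [ENNReal.log_ofReal_of_pos (Real.exp_pos _), Real.log_exp]

theorem le_coe_mul_log {x y : ℝ} {p : ENNReal} (hx : 0 ≤ x) (h : ENNReal.ofReal (Real.exp y) ≤ p) :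
    ((x * y : ℝ) : EReal) ≤ (x : EReal) * ENNReal.log p := by
  rw [EReal.coe_mul]
  refine mul_le_mul_of_nonneg_left ?_ (by exact_mod_cast hx)
  refine le_trans ?_ (ENNReal.log_monotone h)
  rw [ENNReal.log_ofReal_of_pos (Real.exp_pos _), Real.log_exp]

/-- The bounds on the lower tail, in the normalization in which the rate is of order one. -/
theorem exists_log_bounds {ε : ℝ} (hε : 0 < ε) : ∃ c C : ℝ, 0 < c ∧ ∀ᶠ n : ℕ in atTop,
    ((-C : ℝ) : EReal) ≤ ((Real.log n / (n : ℝ) ^ 2 : ℝ) : EReal) * ENNReal.log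
      (gaussianField Bond {w | maxVal (words n) w 0 0 ≤ (timeConst - ε) * n}) ∧
    ((Real.log n / (n : ℝ) ^ 2 : ℝ) : EReal) * ENNReal.log
      (gaussianField Bond {w | maxVal (words n) w 0 0 ≤ (timeConst - ε) * n})
      ≤ ((-c : ℝ) : EReal) := by
  obtain ⟨c, hc, hupper⟩ := exists_measureReal_le_exp hε
  obtain ⟨C, hlower⟩ := exists_exp_le_measureReal hε
  refine ⟨c, C, hc, ?_⟩
  filter_upwards [hupper, hlower, eventually_ge_atTop 2] with n h1 h2 hn
  have hn' : (2 : ℝ) ≤ n := by exact_mod_cast hn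
  have hlog : 0 < Real.log n := Real.log_pos (by linarith)
  have hx : 0 ≤ Real.log n / (n : ℝ) ^ 2 := by positivity
  have hcancel : ∀ a : ℝ, Real.log n / (n : ℝ) ^ 2 * -(a * ((n : ℝ) ^ 2 / Real.log n)) = -a :=
    fun a => by field_simp
  constructor
  · rw [← hcancel C]
    refine le_coe_mul_log hx ?_
    rw [← ofReal_measureReal]
    exact ENNReal.ofReal_le_ofReal h2
  · rw [← hcancel c]
    refine coe_mul_log_le hx ?_
    rw [← ofReal_measureReal]
    exact ENNReal.ofReal_le_ofReal h1

end DirectedPercolation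

theorem theorem1p2 {Ω : Type*} [MeasurableSpace Ω] (P : Measure Ω) [IsProbabilityMeasure P]
    (X : DirectedPercolation.Edge → Ω → ℝ)
    (hindep : iIndepFun X P)
    (hlaw : ∀ e, HasLaw (X e) (gaussianReal 0 1) P) :
    ∃ μ : ℝ,
      (∀ᵐ ω ∂P, Tendsto
        (fun n : ℕ => DirectedPercolation.lastPassage (fun e => X e ω) n / (n : ℝ))
        atTop (𝓝 μ)) ∧
      ∃ ε₀ : ℝ, 0 < ε₀ ∧ ∀ ε : ℝ, 0 < ε → ε < ε₀ →
        (⊥ : EReal) < liminf (fun n : ℕ => ((Real.log n / (n : ℝ) ^ 2 : ℝ) : EReal) *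
          ENNReal.log (P {ω | DirectedPercolation.lastPassage (fun e => X e ω) n
            ≤ (μ - ε) * (n : ℝ)})) atTop ∧
        liminf (fun n : ℕ => ((Real.log n / (n : ℝ) ^ 2 : ℝ) : EReal) *
          ENNReal.log (P {ω | DirectedPercolation.lastPassage (fun e => X e ω) n
            ≤ (μ - ε) * (n : ℝ)})) atTop
        ≤ limsup (fun n : ℕ => ((Real.log n / (n : ℝ) ^ 2 : ℝ) : EReal) *
          ENNReal.log (P {ω | DirectedPercolation.lastPassage (fun e => X e ω) n
            ≤ (μ - ε) * (n : ℝ)})) atTop ∧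
        limsup (fun n : ℕ => ((Real.log n / (n : ℝ) ^ 2 : ℝ) : EReal) *
          ENNReal.log (P {ω | DirectedPercolation.lastPassage (fun e => X e ω) n
            ≤ (μ - ε) * (n : ℝ)})) atTop < 0 := by
  have hlawX := DirectedPercolation.hasLaw_gaussianField hindep hlaw
  have hpass : ∀ ω n, DirectedPercolation.lastPassage (fun e => X e ω) n
      = DirectedPercolation.maxVal (DirectedPercolation.words n)
        (fun e => X (DirectedPercolation.toEdge e) ω) 0 0 :=
    fun ω n => DirectedPercolation.lastPassage_eq_maxVal _ n
  refine ⟨DirectedPercolation.timeConst, ?_, 1, one_pos, fun ε hε _ => ?_⟩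
  · simp_rw [hpass]
    refine ae_of_ae_map hlawX.aemeasurable (p := fun w : DirectedPercolation.Bond → ℝ =>
      Tendsto (fun n : ℕ => DirectedPercolation.maxVal (DirectedPercolation.words n) w 0 0
        / (n : ℝ)) atTop (𝓝 DirectedPercolation.timeConst)) ?_
    rw [hlawX.map_eq]
    exact DirectedPercolation.ae_tendsto_maxVal_words_div
  · have hP : ∀ n : ℕ, P {ω | DirectedPercolation.lastPassage (fun e => X e ω) n
          ≤ (DirectedPercolation.timeConst - ε) * (n : ℝ)}
        = DirectedPercolation.gaussianField DirectedPercolation.Bond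
          {w | DirectedPercolation.maxVal (DirectedPercolation.words n) w 0 0
            ≤ (DirectedPercolation.timeConst - ε) * n} := fun n => by
      simp_rw [hpass]
      rw [← hlawX.map_eq, Measure.map_apply_of_aemeasurable hlawX.aemeasurable
        (measurableSet_le (DirectedPercolation.measurable_maxVal 0 0) measurable_const)]
      rfl
    simp_rw [hP]
    obtain ⟨c, C, hc, h⟩ := DirectedPercolation.exists_log_bounds hε
    refine ⟨lt_of_lt_of_le (EReal.bot_lt_coe (-C)) (le_liminf_of_le (by isBoundedDefault)
      (h.mono fun _ h => h.1)), liminf_le_limsup, lt_of_le_of_lt (limsup_le_of_le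
      (by isBoundedDefault) (h.mono fun _ h => h.2)) ?_⟩
    exact_mod_cast neg_neg_of_pos hc
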